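/- Consider a two-color urn with replacement matrix $R=\begin{pmatrix}a&b\\c&d\end{pmatrix}$, where $a,b,c,d$ are nonnegative integers: when a red ball is drawn it is put back together with $a$ red and $b$ black balls, when a black ball is drawn it is put back together with $c$ red and $d$ black balls. Assume that the urn is balanced, $S:=a+b=c+d$, that $R$ is not triangular, $bc\neq 0$, and that the urn is large, that is, $\sigma:=m/S>\frac12$ where $m:=a-c$. Put $u_2(x,y)=\frac1S(bx-cy)$, and let $(\alpha,\beta)\in\mathbb{N}^2\setminus\{(0,0)\}$ be any initial composition ($\alpha$ red and $\beta$ black balls). Let $(U^{DT}_{(\alpha,\beta)}(n))_{n\in\mathbb{N}}$ be the discrete-time composition process started from $(\alpha,\beta)$ (at each step one ball is drawn uniformly at random, independently of the past given the current composition), and let $(U^{CT}_{(\alpha,\beta)}(t))_{t\ge0}$ be the continuous-time composition process started from $(\alpha,\beta)$ (at any moment each ball in the urn carries an exponential clock of parameter $1$, all the clocks being independent of each other and of the past; when the clock of a ball rings, balls are added by the same replacement rule). Then the limits $$W^{DT}_{(\alpha,\beta)}=\lim_{n\to\infty}n^{-\sigma}\,u_2\big(U^{DT}_{(\alpha,\beta)}(n)\big),\qquad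 W^{CT}_{(\alpha,\beta)}=\lim_{t\to+\infty}e^{-mt}\,u_2\big(U^{CT}_{(\alpha,\beta)}(t)\big)$$ exist almost surely, and the law of $W^{DT}_{(\alpha,\beta)}$ and the law of $W^{CT}_{(\alpha,\beta)}$ are both determined by their moments: each has finite moments of all orders and is the only probability measure on $\mathbb{R}$ with these moments. -/

import Mathlib

open MeasureTheory ProbabilityTheory Filter Topology
open scoped NNReal

namespace PolyaUrn

/-!
The two-colour urn with replacement matrix `(a b; c d)`: a drawn red ball is put back together with
`a` red and `b` black balls, a drawn black ball together with `c` red and `d` black balls.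
A composition is a pair (number of red balls, number of black balls). The urns considered are
balanced, with balance `S = a + b = c + d`.
-/

/-- The ratio `σ = m / S` of the eigenvalues `m = a - c` and `S = a + b`. -/
noncomputable def ratio (a b c : ℕ) : ℝ := ((a : ℝ) - c) / ((a : ℝ) + b)

/-- The eigenform `u₂(x, y) = (b x - c y) / S`, with `S = a + b`. -/
noncomputable def u₂ (a b c : ℕ) (v : ℕ × ℕ) : ℝ :=
  ((b : ℝ) * v.1 - (c : ℝ) * v.2) / ((a : ℝ) + b)

/-- The probability to go from composition `v` to composition `w` by drawing a ball uniformly at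
random and applying the replacement rule. -/
noncomputable def stepProb (a b c d : ℕ) (v w : ℕ × ℕ) : ℝ :=
  (v.1 : ℝ) / ((v.1 : ℝ) + v.2) * (if w = v + (a, b) then 1 else 0) +
    (v.2 : ℝ) / ((v.1 : ℝ) + v.2) * (if w = v + (c, d) then 1 else 0)

/-- `U` is (a version of) the discrete-time urn process with initial composition `(α, β)`:
the Markov chain on compositions started at `(α, β)` with transition probabilities `stepProb`. -/
structure IsDiscreteTimeUrn {Ω : Type*} [MeasurableSpace Ω] (P : Measure Ω)
    (a b c d α β : ℕ) (U : ℕ → Ω → ℕ × ℕ) : Prop where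
  measurable : ∀ n, Measurable (U n)
  initial : ∀ᵐ ω ∂P, U 0 ω = (α, β)
  markov : ∀ (n : ℕ) (u : ℕ → ℕ × ℕ),
    P.real {ω | ∀ k ≤ n + 1, U k ω = u k} =
      P.real {ω | ∀ k ≤ n, U k ω = u k} * stepProb a b c d (u n) (u (n + 1))

/-- Data realizing the continuous-time urn. Here `τ n` is the time of the `n`-th ring, `V n` is the
composition just after it and `ℱ n` is the information available at that time. Between the `n`-th
and the next ring there are `α + β + n S` balls, the first `(V n).1` of which are taken to be the
red ones; `E n j` is the time that the clock of ball `j` still has to run, counted from `τ n`.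
At every such moment the clocks are independent, exponentially distributed with parameter `1`,
and independent of the past. The ball whose clock rings first determines the replacement. -/
structure IsClockedUrn {Ω : Type*} [mΩ : MeasurableSpace Ω] (P : Measure Ω)
    (a b c d α β : ℕ) (ℱ : Filtration ℕ mΩ) (V : ℕ → Ω → ℕ × ℕ) (τ : ℕ → Ω → ℝ)
    (E : ∀ n : ℕ, Fin (α + β + n * (a + b)) → Ω → ℝ) : Prop where
  measurable_V : ∀ n, Measurable[ℱ n] (V n)
  measurable_τ : ∀ n, Measurable[ℱ n] (τ n)
  measurable_E : ∀ n j, Measurable (E n j)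
  initial_V : ∀ᵐ ω ∂P, V 0 ω = (α, β)
  initial_τ : ∀ᵐ ω ∂P, τ 0 ω = 0
  clocks_exp : ∀ n j, P.map (E n j) = expMeasure 1
  clocks_indep : ∀ n, iIndepFun (E n) P
  clocks_indep_past : ∀ n,
    Indep (MeasurableSpace.comap (fun ω j => E n j ω) MeasurableSpace.pi) (ℱ n) P
  ring : ∀ᵐ ω ∂P, ∀ n, ∃ j, (∀ i, E n j ω ≤ E n i ω) ∧ τ (n + 1) ω = τ n ω + E n j ω ∧
    V (n + 1) ω = V n ω + if (j : ℕ) < (V n ω).1 then (a, b) else (c, d)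

/-- `U` is (a version of) the continuous-time urn process with initial composition `(α, β)`: the
composition at time `t` is the one just after the last ring before or at `t`. -/
def IsContinuousTimeUrn {Ω : Type*} [mΩ : MeasurableSpace Ω] (P : Measure Ω)
    (a b c d α β : ℕ) (U : ℝ≥0 → Ω → ℕ × ℕ) : Prop :=
  ∃ (ℱ : Filtration ℕ mΩ) (V : ℕ → Ω → ℕ × ℕ) (τ : ℕ → Ω → ℝ)
    (E : ∀ n : ℕ, Fin (α + β + n * (a + b)) → Ω → ℝ),
    IsClockedUrn P a b c d α β ℱ V τ E ∧
      ∀ᵐ ω ∂P, ∀ (t : ℝ≥0) (n : ℕ), τ n ω ≤ t → (t : ℝ) < τ (n + 1) ω → U t ω = V n ω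

/-- `W` is a version of the almost sure limit `lim n ^ (-σ) u₂(U n)`. -/
def IsDiscreteTimeLimit {Ω : Type*} [MeasurableSpace Ω] (P : Measure Ω)
    (a b c : ℕ) (U : ℕ → Ω → ℕ × ℕ) (W : Ω → ℝ) : Prop :=
  Measurable W ∧ ∀ᵐ ω ∂P,
    Tendsto (fun n : ℕ => 1 / (n : ℝ) ^ ratio a b c * u₂ a b c (U n ω)) atTop (𝓝 (W ω))

/-- `W` is a version of the almost sure limit `lim e ^ (-m t) u₂(U t)`, where `m = a - c`. -/
def IsContinuousTimeLimit {Ω : Type*} [MeasurableSpace Ω] (P : Measure Ω)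
    (a b c : ℕ) (U : ℝ≥0 → Ω → ℕ × ℕ) (W : Ω → ℝ) : Prop :=
  Measurable W ∧ ∀ᵐ ω ∂P,
    Tendsto (fun t : ℝ≥0 => Real.exp (-((a : ℝ) - c) * t) * u₂ a b c (U t ω)) atTop (𝓝 (W ω))

/-- A law on the real line is determined by its moments: it has finite moments of all orders, and
it is the only probability measure with these moments. -/
def IsDeterminedByMoments (ν : Measure ℝ) : Prop :=
  (∀ k : ℕ, Integrable (fun x : ℝ => x ^ k) ν) ∧
    ∀ ν' : Measure ℝ, IsProbabilityMeasure ν' →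
      (∀ k : ℕ, Integrable (fun x : ℝ => x ^ k) ν') →
      (∀ k : ℕ, ∫ x, x ^ k ∂ν' = ∫ x, x ^ k ∂ν) → ν' = ν

end PolyaUrn

/-! A law with exponentially decaying tail has an exponential moment, hence is determined by its
moments. So everything reduces to almost sure convergence and tail bounds.

Discrete time. Since `u₂` is a left eigenform of the replacement rule, one draw from an urn with `T`
balls multiplies its conditional mean by `1 + m/T`. Dividing by the product `urnGrowth` of these
factors, which is of order `n ^ σ` by Euler's limit for the Gamma function, gives a martingale `M`
with centred two-valued increments of size `O(n ^ (-σ))`. Its Laplace transform is estimated at `|l|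
= N ^ σ` by splitting at time `N`. Up to `N` the trivial bound `|M_N| = O(N ^ (1 - σ))` gives `|l
M_N| = O(N)`. After `N` the subgaussian increments contribute `l ^ 2 ∑_{k ≥ N} O(k ^ (-2σ)) = O(N)`,
and this is where `σ > 1/2` is needed. Hence `E exp(l M_n) ≤ exp(D N)` for `n ≥ N`
(`exists_mgf_normalized_le`), and Chernoff's bound makes `|M_n| ≥ K N ^ (1 - σ)` have probability at
most `2 exp(-N)`. This is stronger than an exponential tail, and the surplus is spent in continuous
time.

Continuous time. The first of `T` unit exponential clocks to ring is uniform, so the compositions at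
the rings form a discrete-time urn. The waiting time is exponential of parameter `T`, so `T_n exp(-S
τ_n)` is a martingale with explicit moment bounds; its limit `ξ` exceeds `K N` with probability at
most `exp(-N)`. Since `m = σ S`, the two limits satisfy `W^CT = (ξ / S) ^ σ W^DT`. Off an event of
probability at most `3 exp(-N)`, the product is of order `N ^ σ · N ^ (1 - σ) = N`: again an
exponential tail. A union bound suffices, without independence of the two factors. -/

namespace PolyaUrn

/-! ### Exponential tails and determinacy of moments -/

/-- A variable whose tail decays exponentially along a lattice has an exponential moment. -/
theorem integrable_exp_abs_of_tail {Ω : Type*} [MeasurableSpace Ω] (P : Measure Ω)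
    [IsProbabilityMeasure P] {X : Ω → ℝ} (hX : Measurable X) {K C c : ℝ} (hK : 0 < K)
    (hc : 0 < c) (htail : ∀ N : ℕ, 1 ≤ N → P.real {ω | K * N < |X ω|} ≤ C * Real.exp (-c * N)) :
    ∃ ε > 0, Integrable (fun ω => Real.exp (ε * |X ω|)) P := by
  -- Half the decay rate: the sum over the layers `K N < |X| ≤ K (N + 1)` is then geometric of ratio
  -- `exp(-c/2)`.
  refine ⟨c / (2 * K), by positivity, ?_⟩
  have hm : Measurable (fun ω => Real.exp (c / (2 * K) * |X ω|)) := by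
    have := hX.abs
    fun_prop
  refine ⟨hm.aestronglyMeasurable, ?_⟩
  have hset : ∀ N : ℕ, MeasurableSet {ω | K * N < |X ω|} := fun N =>
    measurableSet_lt measurable_const hX.abs
  -- The maximum with `1` covers `N = 0`, on which `htail` is silent.
  set D : ℝ := max C 1
  have hpt : ∀ ω, ENNReal.ofReal (Real.exp (c / (2 * K) * |X ω|)) ≤
      ENNReal.ofReal (Real.exp (c / 2)) + ∑' N : ℕ, ({ω | K * N < |X ω|}).indicator
        (fun _ => ENNReal.ofReal (Real.exp (c / 2 * (N + 1)))) ω := by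
    intro ω
    by_cases h0 : |X ω| = 0
    · rw [h0]
      refine le_trans (ENNReal.ofReal_le_ofReal ?_) le_self_add
      simp only [mul_zero]
      exact Real.exp_le_exp.2 (by positivity)
    have hpos : 0 < |X ω| / K := div_pos (lt_of_le_of_ne (abs_nonneg _) (Ne.symm h0)) hK
    obtain ⟨N, hN⟩ : ∃ N : ℕ, ⌈|X ω| / K⌉₊ = N + 1 :=
      Nat.exists_eq_succ_of_ne_zero (by simpa using hpos)
    have h1 : (N : ℝ) < |X ω| / K := by
      have := Nat.lt_ceil.1 (show N < ⌈|X ω| / K⌉₊ by omega)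
      exact this
    have h2 : |X ω| / K ≤ N + 1 := by
      have := Nat.le_ceil (|X ω| / K)
      rw [hN] at this
      exact_mod_cast this
    refine le_trans ?_ le_add_self
    refine le_trans ?_ (ENNReal.le_tsum N)
    rw [Set.indicator_of_mem]
    · apply ENNReal.ofReal_le_ofReal
      apply Real.exp_le_exp.2
      calc c / (2 * K) * |X ω| = c / 2 * (|X ω| / K) := by field_simp
        _ ≤ _ := by gcongr
    · change K * N < |X ω|
      rw [lt_div_iff₀ hK] at h1
      linarith
  have hterm : ∀ N : ℕ, P {ω | K * N < |X ω|} ≤ ENNReal.ofReal (D * Real.exp (-c * N)) := by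
    intro N
    rw [← ofReal_measureReal]
    apply ENNReal.ofReal_le_ofReal
    rcases Nat.eq_zero_or_pos N with rfl | hN
    · refine (measureReal_le_one (μ := P)).trans ?_
      simp only [Nat.cast_zero, mul_zero, Real.exp_zero, mul_one]
      exact le_max_right C 1
    · exact (htail N hN).trans (by gcongr; exact le_max_left _ _)
  have hsum : Summable fun N : ℕ => Real.exp (c / 2 * (N + 1)) * (D * Real.exp (-c * N)) := by
    have : (fun N : ℕ => Real.exp (c / 2 * (N + 1)) * (D * Real.exp (-c * N))) =
        fun N : ℕ => (D * Real.exp (c / 2)) * (Real.exp (-(c / 2))) ^ N := by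
      funext N
      rw [← Real.exp_nat_mul]
      have : Real.exp (c / 2 * (N + 1)) * Real.exp (-c * N) =
          Real.exp (c / 2) * Real.exp (N * -(c / 2)) := by
        rw [← Real.exp_add, ← Real.exp_add]
        congr 1
        ring
      calc _ = D * (Real.exp (c / 2 * (N + 1)) * Real.exp (-c * N)) := by ring
        _ = _ := by rw [this]; ring
    rw [this]
    exact (summable_geometric_of_lt_one (Real.exp_pos _).le
      (Real.exp_lt_one_iff.2 (by linarith))).mul_left _
  rw [hasFiniteIntegral_iff_ofReal (ae_of_all _ fun _ => (Real.exp_pos _).le)]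
  refine lt_of_le_of_lt (lintegral_mono hpt) ?_
  rw [lintegral_add_left measurable_const, lintegral_tsum
    (fun N => (measurable_const.indicator (hset N)).aemeasurable)]
  refine ENNReal.add_lt_top.2 ⟨by simp, ?_⟩
  refine lt_of_le_of_lt (ENNReal.tsum_le_tsum fun N => ?_)
    (lt_of_le_of_ne le_top hsum.tsum_ofReal_ne_top)
  rw [lintegral_indicator_const (hset N), ENNReal.ofReal_mul (Real.exp_pos _).le]
  gcongr
  exact hterm N

/-- The power series of `cosh` has only even, hence nonnegative, terms, so Tonelli applies even when
the integral is infinite. Finiteness of exponential moments can thus be read off the moments alone.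
-/
theorem lintegral_cosh_eq_tsum (ν : Measure ℝ)
    (hint : ∀ k : ℕ, Integrable (fun x : ℝ => x ^ k) ν) (t : ℝ) :
    ∫⁻ x, ENNReal.ofReal (Real.cosh (t * x)) ∂ν =
      ∑' k : ℕ, ENNReal.ofReal (t ^ (2 * k) / (2 * k).factorial * ∫ x, x ^ (2 * k) ∂ν) := by
  have h1 : ∀ x : ℝ, ENNReal.ofReal (Real.cosh (t * x)) =
      ∑' k : ℕ, ENNReal.ofReal (t ^ (2 * k) / (2 * k).factorial * x ^ (2 * k)) := by
    intro x
    have hs := Real.hasSum_cosh (t * x)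
    rw [← hs.tsum_eq, ENNReal.ofReal_tsum_of_nonneg _ hs.summable]
    · congr 1
      funext k
      rw [mul_pow]
      congr 1
      ring
    · intro k
      rw [pow_mul]
      positivity
  simp_rw [h1]
  rw [lintegral_tsum (fun k => by fun_prop)]
  congr 1
  funext k
  rw [← integral_const_mul, ofReal_integral_eq_lintegral_ofReal ((hint _).const_mul _)]
  refine ae_of_all _ fun x => ?_
  simp only [Pi.zero_apply, pow_mul]
  positivity

theorem integrable_exp_mul_of_lintegral_cosh_lt_top (ν : Measure ℝ) {t : ℝ}
    (h : ∫⁻ x, ENNReal.ofReal (Real.cosh (t * x)) ∂ν < ⊤) :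
    Integrable (fun x => Real.exp (t * x)) ν := by
  have hc : Integrable (fun x => Real.cosh (t * x)) ν := by
    refine ⟨(Real.continuous_cosh.comp (continuous_const.mul continuous_id)).aestronglyMeasurable,
      ?_⟩
    rwa [hasFiniteIntegral_iff_ofReal (ae_of_all _ fun _ => (Real.cosh_pos _).le)]
  refine (hc.const_mul 2).mono' (by fun_prop) (ae_of_all _ fun x => ?_)
  rw [Real.norm_eq_abs, abs_of_pos (Real.exp_pos _), Real.cosh_eq]
  have := Real.exp_pos (-(t * x))
  linarith

theorem Ioo_subset_interior_integrableExpSet {ν : Measure ℝ} {ε : ℝ}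
    (h1 : Integrable (fun x => Real.exp (ε * x)) ν)
    (h2 : Integrable (fun x => Real.exp (-ε * x)) ν) :
    Set.Ioo (-ε) ε ⊆ interior (integrableExpSet id ν) := by
  rw [isOpen_Ioo.subset_interior_iff]
  intro t ht
  exact integrable_exp_mul_of_le_of_le h2 h1 ht.1.le ht.2.le

/-- Laws with an exponential moment are determined by their moments. -/
theorem isDeterminedByMoments_of_integrable_exp_abs {ν : Measure ℝ} [IsProbabilityMeasure ν]
    {ε : ℝ} (hε : 0 < ε) (hexp : Integrable (fun x => Real.exp (ε * |x|)) ν) :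
    IsDeterminedByMoments ν := by
  have hle : ∀ s : ℝ, |s| ≤ ε → Integrable (fun x => Real.exp (s * x)) ν := by
    intro s hs
    refine hexp.mono' (by fun_prop) (ae_of_all _ fun x => ?_)
    rw [Real.norm_eq_abs, abs_of_pos (Real.exp_pos _), Real.exp_le_exp]
    calc s * x ≤ |s * x| := le_abs_self _
      _ = |s| * |x| := abs_mul _ _
      _ ≤ _ := by gcongr
  have hp := hle ε (by rw [abs_of_pos hε])
  have hn := hle (-ε) (by rw [abs_neg, abs_of_pos hε])
  have hsub := Ioo_subset_interior_integrableExpSet hp hn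
  have h0 : (0 : ℝ) ∈ Set.Ioo (-ε) ε := ⟨by linarith, hε⟩
  have hmom : ∀ k : ℕ, Integrable (fun x : ℝ => x ^ k) ν := fun k =>
    integrable_pow_of_mem_interior_integrableExpSet (hsub h0) k
  refine ⟨hmom, fun ν' hν' hmom' heq => ?_⟩
  have hcosh : ∫⁻ x, ENNReal.ofReal (Real.cosh (ε * x)) ∂ν < ⊤ := by
    have : Integrable (fun x => Real.cosh (ε * x)) ν := by
      have := (hp.add hn).div_const 2
      refine this.congr (ae_of_all _ fun x => ?_)
      simp [Real.cosh_eq]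
    have := this.2
    rwa [hasFiniteIntegral_iff_ofReal (ae_of_all _ fun _ => (Real.cosh_pos _).le)] at this
  -- The competitor `ν'` has the same even moments, so it inherits the exponential moment of `ν`.
  have hcosh' : ∫⁻ x, ENNReal.ofReal (Real.cosh (ε * x)) ∂ν' < ⊤ := by
    rw [lintegral_cosh_eq_tsum ν' hmom']
    simp_rw [heq]
    rwa [← lintegral_cosh_eq_tsum ν hmom]
  have hp' := integrable_exp_mul_of_lintegral_cosh_lt_top ν' hcosh'
  have hn' : Integrable (fun x => Real.exp (-ε * x)) ν' := by
    apply integrable_exp_mul_of_lintegral_cosh_lt_top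
    simpa using hcosh'
  have hsub' := Ioo_subset_interior_integrableExpSet hp' hn'
  -- Near `0` both functions are sums of power series with coefficients the moments over `n!`.
  have hmgf : mgf id ν' =ᶠ[𝓝 0] mgf id ν := by
    have e1 := hasFPowerSeriesAt_mgf (hsub' h0)
    have e2 := hasFPowerSeriesAt_mgf (hsub h0)
    have : (fun n : ℕ => (∫ x, id x ^ n * Real.exp (0 * id x) ∂ν' : ℝ) / n.factorial) =
        fun n : ℕ => (∫ x, id x ^ n * Real.exp (0 * id x) ∂ν : ℝ) / n.factorial := by
      funext n
      simp [heq n]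
    rw [this] at e1
    filter_upwards [e1.eventually_hasSum_sub, e2.eventually_hasSum_sub] with y h1 h2
    exact h1.unique h2
  -- Identity theorem: agreement on real points accumulating at `0` spreads to the vertical strip,
  -- which contains the imaginary axis and so the characteristic functions.
  have hstrip : Set.EqOn (complexMGF id ν') (complexMGF id ν)
      {z | z.re ∈ Set.Ioo (-ε) ε} := by
    refine AnalyticOnNhd.eqOn_of_preconnected_of_frequently_eq
      (analyticOnNhd_complexMGF.mono fun z hz => hsub' hz)
      (analyticOnNhd_complexMGF.mono fun z hz => hsub hz)
      ((convex_Ioo (-ε) ε).linear_preimage Complex.reLm).isPreconnected (z₀ := ((0 : ℝ) : ℂ))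
      (by simpa using hε) ?_
    have h_real : ∃ᶠ x : ℝ in 𝓝[≠] 0, complexMGF id ν' x = complexMGF id ν x := by
      refine Eventually.frequently ?_
      filter_upwards [nhdsWithin_le_nhds hmgf] with x hx
      rw [complexMGF_ofReal, complexMGF_ofReal, hx]
    rw [frequently_iff_seq_forall] at h_real ⊢
    obtain ⟨xs, hx_tendsto, hx_eq⟩ := h_real
    refine ⟨fun n => xs n, ?_, fun n => hx_eq n⟩
    rw [tendsto_nhdsWithin_iff] at hx_tendsto ⊢
    constructor
    · exact (Complex.continuous_ofReal.tendsto 0).comp hx_tendsto.1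
    · simpa using hx_tendsto.2
  refine Measure.ext_of_charFun (funext fun t => ?_)
  rw [← complexMGF_id_mul_I, ← complexMGF_id_mul_I]
  exact hstrip (by simpa using hε)

/-- A variable with exponentially decaying tail has a law determined by its moments. -/
theorem isDeterminedByMoments_map_of_tail {Ω : Type*} [MeasurableSpace Ω] (P : Measure Ω)
    [IsProbabilityMeasure P] {X : Ω → ℝ} (hX : Measurable X) {K C c : ℝ} (hK : 0 < K)
    (hc : 0 < c) (htail : ∀ N : ℕ, 1 ≤ N → P.real {ω | K * N < |X ω|} ≤ C * Real.exp (-c * N)) :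
    IsDeterminedByMoments (P.map X) := by
  obtain ⟨ε, hε, hint⟩ := integrable_exp_abs_of_tail P hX hK hc htail
  have : IsProbabilityMeasure (P.map X) := Measure.isProbabilityMeasure_map hX.aemeasurable
  refine isDeterminedByMoments_of_integrable_exp_abs hε ?_
  rw [integrable_map_measure (by fun_prop) hX.aemeasurable]
  exact hint

/-! ### Asymptotics of the growth factor -/

/-- The growth factor `∏ k < n, (1 + σ / (s + k))`. -/
noncomputable def growth (s σ : ℝ) (n : ℕ) : ℝ := ∏ k ∈ Finset.range n, (1 + σ / (s + k))

theorem growth_succ (s σ : ℝ) (n : ℕ) :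
    growth s σ (n + 1) = growth s σ n * (1 + σ / (s + n)) := by
  simp [growth, Finset.prod_range_succ]

theorem growth_pos {s σ : ℝ} (hs : 0 < s) (hσ : 0 < σ) (n : ℕ) : 0 < growth s σ n :=
  Finset.prod_pos fun k _ => by positivity

/-- The factors are `(s + σ + k) / (s + k)`, so the product is a quotient of the products in Euler's
limit formula for `Γ(s)` and `Γ(s + σ)`. -/
theorem growth_succ_eq_gammaSeq {s σ : ℝ} (hs : 0 < s) (hσ : 0 < σ) {n : ℕ} (hn : 1 ≤ n) :
    growth s σ (n + 1) = (n : ℝ) ^ σ * (Real.GammaSeq s n / Real.GammaSeq (s + σ) n) := by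
  have hn' : (0 : ℝ) < n := by exact_mod_cast hn
  have h1 : 0 < ∏ j ∈ Finset.range (n + 1), (s + j) := Finset.prod_pos fun k _ => by positivity
  have h2 : 0 < ∏ j ∈ Finset.range (n + 1), (s + σ + j) :=
    Finset.prod_pos fun k _ => by positivity
  have h3 : growth s σ (n + 1) =
      (∏ j ∈ Finset.range (n + 1), (s + σ + j)) / ∏ j ∈ Finset.range (n + 1), (s + j) := by
    rw [growth, ← Finset.prod_div_distrib]
    refine Finset.prod_congr rfl fun k _ => ?_
    have : (s + k) ≠ 0 := by positivity
    field_simp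
    ring
  have h4 : (0 : ℝ) < n.factorial := by exact_mod_cast n.factorial_pos
  have h5 : (0 : ℝ) < (n : ℝ) ^ s := Real.rpow_pos_of_pos hn' _
  have h6 : (0 : ℝ) < (n : ℝ) ^ σ := Real.rpow_pos_of_pos hn' _
  rw [h3, Real.GammaSeq, Real.GammaSeq, Real.rpow_add hn']
  field_simp

theorem tendsto_growth_div_rpow {s σ : ℝ} (hs : 0 < s) (hσ : 0 < σ) :
    Tendsto (fun n : ℕ => growth s σ n / (n : ℝ) ^ σ) atTop
      (𝓝 (Real.Gamma s / Real.Gamma (s + σ))) := by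
  rw [← tendsto_add_atTop_iff_nat 1]
  have h1 : Tendsto (fun n : ℕ => Real.GammaSeq s n / Real.GammaSeq (s + σ) n) atTop
      (𝓝 (Real.Gamma s / Real.Gamma (s + σ))) :=
    (Real.GammaSeq_tendsto_Gamma s).div (Real.GammaSeq_tendsto_Gamma (s + σ))
      (Real.Gamma_pos_of_pos (by positivity)).ne'
  -- The Gamma formula has `n ^ σ` against `growth` at `n + 1`; this quotient absorbs the shift.
  have h2 : Tendsto (fun n : ℕ => ((n : ℝ) / (n + 1)) ^ σ) atTop (𝓝 1) := by
    have := (tendsto_natCast_div_add_atTop (1 : ℝ)).rpow_const (p := σ) (Or.inr hσ.le)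
    simpa using this
  have h3 := h2.mul h1
  rw [one_mul] at h3
  refine h3.congr' ?_
  filter_upwards [eventually_ge_atTop 1] with n hn
  rw [growth_succ_eq_gammaSeq hs hσ hn, Real.div_rpow (by positivity) (by positivity)]
  push_cast
  ring

theorem exists_rpow_le_growth {s σ : ℝ} (hs : 0 < s) (hσ : 0 < σ) :
    ∃ κ > 0, ∀ n : ℕ, κ * (n : ℝ) ^ σ ≤ growth s σ n := by
  set L := Real.Gamma s / Real.Gamma (s + σ)
  have hL : 0 < L :=
    div_pos (Real.Gamma_pos_of_pos hs) (Real.Gamma_pos_of_pos (by positivity))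
  obtain ⟨N, hN⟩ := eventually_atTop.1
    ((tendsto_growth_div_rpow hs hσ).eventually_const_le (half_lt_self hL))
  have hex : ∀ M : ℕ, ∃ κ > 0, ∀ n < M, κ * (n : ℝ) ^ σ ≤ growth s σ n := by
    intro M
    induction M with
    | zero => exact ⟨1, one_pos, fun n hn => absurd hn (Nat.not_lt_zero n)⟩
    | succ M ih =>
      obtain ⟨κ, hκ, h⟩ := ih
      -- Adding `1` keeps the denominator positive at `M = 0`.
      refine ⟨min κ (growth s σ M / ((M : ℝ) ^ σ + 1)),
        lt_min hκ (div_pos (growth_pos hs hσ M) (by positivity)), fun n hn => ?_⟩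
      rcases Nat.lt_succ_iff_lt_or_eq.1 hn with hlt | rfl
      · exact le_trans (by gcongr; exact min_le_left _ _) (h n hlt)
      · calc _ ≤ growth s σ n / ((n : ℝ) ^ σ + 1) * (n : ℝ) ^ σ := by
              gcongr; exact min_le_right _ _
          _ ≤ growth s σ n / ((n : ℝ) ^ σ + 1) * ((n : ℝ) ^ σ + 1) := by
              have := (growth_pos hs hσ n).le
              gcongr
              linarith
          _ = _ := by field_simp
  obtain ⟨κ, hκ, h⟩ := hex (N + 1)
  refine ⟨min κ (L / 2), lt_min hκ (by positivity), fun n => ?_⟩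
  rcases Nat.lt_or_ge n (N + 1) with hlt | hge
  · exact le_trans (by gcongr; exact min_le_left _ _) (h n hlt)
  · have hn : (0 : ℝ) < (n : ℝ) ^ σ :=
      Real.rpow_pos_of_pos (by exact_mod_cast (by omega : 0 < n)) _
    have := hN n (by omega)
    rw [le_div_iff₀ hn] at this
    exact le_trans (by gcongr; exact min_le_right _ _) this

/-- The mean value estimate for `x ^ (-ρ)`, from `log(1 + 1/k) ≥ 1/(k + 1)` and `exp y ≥ 1 + y`. It
bounds a series of powers by a telescoping one. -/
theorem rpow_neg_sub_rpow_neg_ge {ρ : ℝ} (hρ : 0 < ρ) {k : ℕ} (hk : 1 ≤ k) :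
    ρ * (((k + 1 : ℕ) : ℝ) ^ (-(1 + ρ))) ≤ (k : ℝ) ^ (-ρ) - ((k + 1 : ℕ) : ℝ) ^ (-ρ) := by
  have hk0 : (0 : ℝ) < k := by exact_mod_cast hk
  push_cast
  have hk1 : (0 : ℝ) < (k : ℝ) + 1 := by positivity
  have hq : (0 : ℝ) < ((k : ℝ) + 1) / k := by positivity
  have e1 : (k : ℝ) ^ (-ρ) = ((k : ℝ) + 1) ^ (-ρ) * (((k : ℝ) + 1) / k) ^ ρ := by
    rw [Real.div_rpow hk1.le hk0.le, Real.rpow_neg hk0.le, Real.rpow_neg hk1.le]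
    have := (Real.rpow_pos_of_pos hk1 ρ).ne'
    field_simp
  have e2 : ((k : ℝ) + 1) ^ (-(1 + ρ)) = ((k : ℝ) + 1) ^ (-ρ) * (1 / ((k : ℝ) + 1)) := by
    rw [show -(1 + ρ) = -ρ + -1 by ring, Real.rpow_add hk1, Real.rpow_neg_one, one_div]
  have h1 : 1 + ρ * (1 / ((k : ℝ) + 1)) ≤ (((k : ℝ) + 1) / k) ^ ρ := by
    rw [Real.rpow_def_of_pos hq]
    have hlog : 1 / ((k : ℝ) + 1) ≤ Real.log (((k : ℝ) + 1) / k) := by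
      have := Real.one_sub_inv_le_log_of_pos hq
      refine le_trans (le_of_eq ?_) this
      field_simp
      ring
    have := Real.add_one_le_exp (Real.log (((k : ℝ) + 1) / k) * ρ)
    nlinarith
  rw [e1, e2]
  have := Real.rpow_pos_of_pos hk1 (-ρ)
  nlinarith

/-- The variance remaining after time `N`. It is summable exactly because the urn is large: `2σ >
1`. -/
theorem sum_Ico_rpow_neg_le {σ : ℝ} (hσ : 1 / 2 < σ) {N : ℕ} (hN : 1 ≤ N) {n : ℕ} (hn : N ≤ n) :
    ∑ k ∈ Finset.Ico N n, (((k + 1 : ℕ) : ℝ) ^ σ)⁻¹ ^ 2 ≤ (N : ℝ) ^ (1 - 2 * σ) / (2 * σ - 1) := by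
  have hρ : 0 < 2 * σ - 1 := by linarith
  rw [le_div_iff₀ hρ, mul_comm, Finset.mul_sum]
  have hle : ∑ k ∈ Finset.Ico N n, (2 * σ - 1) * (((k + 1 : ℕ) : ℝ) ^ σ)⁻¹ ^ 2 ≤
      ∑ k ∈ Finset.Ico N n,
        ((k : ℝ) ^ (-(2 * σ - 1)) - ((k + 1 : ℕ) : ℝ) ^ (-(2 * σ - 1))) := by
    refine Finset.sum_le_sum fun k hk => ?_
    have hk1 : 1 ≤ k := hN.trans (Finset.mem_Ico.1 hk).1
    refine le_trans (le_of_eq ?_) (rpow_neg_sub_rpow_neg_ge hρ hk1)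
    congr 1
    rw [← Real.rpow_neg (by positivity), ← Real.rpow_natCast, ← Real.rpow_mul (by positivity)]
    congr 1
    push_cast
    ring
  refine hle.trans ?_
  have htel : ∑ k ∈ Finset.Ico N n,
      ((k : ℝ) ^ (-(2 * σ - 1)) - ((k + 1 : ℕ) : ℝ) ^ (-(2 * σ - 1))) =
      (N : ℝ) ^ (-(2 * σ - 1)) - (n : ℝ) ^ (-(2 * σ - 1)) := by
    clear hle
    induction n, hn using Nat.le_induction with
    | base => simp
    | succ n hn ih => rw [Finset.sum_Ico_succ_top hn, ih]; ring
  rw [htel]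
  have h1 : (0 : ℝ) ≤ (n : ℝ) ^ (-(2 * σ - 1)) := by positivity
  have h2 : -(2 * σ - 1) = 1 - 2 * σ := by ring
  rw [h2] at h1 ⊢
  linarith

/-! ### The Markov property of the discrete-time urn -/

/-- The composition history up to time `n`. -/
def history {Ω : Type*} (U : ℕ → Ω → ℕ × ℕ) (n : ℕ) (ω : Ω) : Fin (n + 1) → ℕ × ℕ :=
  fun k => U k ω

theorem history_last {Ω : Type*} (U : ℕ → Ω → ℕ × ℕ) (n : ℕ) (ω : Ω) :
    history U n ω (Fin.last n) = U n ω := by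
  simp [history]

section Discrete

variable {Ω : Type*} [mΩ : MeasurableSpace Ω] {P : Measure Ω}
  {a b c d α β : ℕ} {U : ℕ → Ω → ℕ × ℕ}

theorem measurable_history (hU : ∀ n, Measurable (U n)) (n : ℕ) : Measurable (history U n) :=
  measurable_pi_lambda _ fun k => hU k

/-- The filtration generated by the composition process. -/
def historyFiltration (hU : ∀ n, Measurable (U n)) : Filtration ℕ mΩ where
  seq n := MeasurableSpace.comap (history U n) inferInstance
  mono' := by
    intro i j hij
    have : history U i = (fun (p : Fin (j + 1) → ℕ × ℕ) (k : Fin (i + 1)) =>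
        p (Fin.castLE (by omega) k)) ∘ history U j := by
      funext ω k
      rfl
    change MeasurableSpace.comap (history U i) _ ≤ MeasurableSpace.comap (history U j) _
    rw [this, ← MeasurableSpace.comap_comp]
    exact MeasurableSpace.comap_mono
      (measurable_pi_lambda _ fun k => measurable_pi_apply _).comap_le
  le' n := (measurable_history hU n).comap_le

theorem measurable_historyFiltration (hU : ∀ n, Measurable (U n)) (n : ℕ) :
    Measurable[historyFiltration hU n] (U n) := by
  have h1 : Measurable[historyFiltration hU n] (history U n) := comap_measurable _
  exact (measurable_pi_apply (Fin.last n)).comp h1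

/-- The mean of `g` after one draw from an urn with composition `v`. -/
noncomputable def drawMean (a b c d : ℕ) (g : ℕ × ℕ → ℝ) (v : ℕ × ℕ) : ℝ :=
  (v.1 : ℝ) / ((v.1 : ℝ) + v.2) * g (v + (a, b)) + (v.2 : ℝ) / ((v.1 : ℝ) + v.2) * g (v + (c, d))

theorem IsDiscreteTimeUrn.measureReal_history_inter (hU : IsDiscreteTimeUrn P a b c d α β U)
    (n : ℕ) (u : Fin (n + 1) → ℕ × ℕ) (w : ℕ × ℕ) :
    P.real (history U n ⁻¹' {u} ∩ U (n + 1) ⁻¹' {w}) =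
      P.real (history U n ⁻¹' {u}) * stepProb a b c d (u (Fin.last n)) w := by
  -- The field `markov` speaks of infinite sequences; the finite history is extended by the constant
  -- `w`, of which only the entry `n + 1` matters.
  let u' : ℕ → ℕ × ℕ := fun k => if h : k < n + 1 then u ⟨k, h⟩ else w
  have h := hU.markov n u'
  have hu' : ∀ ω, (∀ k ≤ n, U k ω = u' k) ↔ history U n ω = u := by
    intro ω
    constructor
    · intro h
      funext k
      have := h k (by omega)
      simpa [u', history, Nat.le_of_lt_succ k.2] using this
    · intro h k hk
      have := congrFun h ⟨k, by omega⟩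
      simpa [u', hk, history] using this
  have e1 : {ω | ∀ k ≤ n, U k ω = u' k} = history U n ⁻¹' {u} := by
    ext ω
    exact hu' ω
  have e2 : {ω | ∀ k ≤ n + 1, U k ω = u' k} = history U n ⁻¹' {u} ∩ U (n + 1) ⁻¹' {w} := by
    ext ω
    have hw : u' (n + 1) = w := by simp [u']
    constructor
    · intro h
      exact ⟨(hu' ω).1 fun k hk => h k (by omega), (h (n + 1) le_rfl).trans hw⟩
    · rintro ⟨h1, h2⟩ k hk
      rcases Nat.lt_or_ge k (n + 1) with hlt | hge
      · exact (hu' ω).2 h1 k (by omega)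
      · obtain rfl : k = n + 1 := by omega
        exact h2.trans hw.symm
  have e3 : u' n = u (Fin.last n) := by simp [u', Fin.last]
  have e4 : u' (n + 1) = w := by simp [u']
  rw [e1, e2, e3, e4] at h
  exact h

variable [IsProbabilityMeasure P]

theorem IsDiscreteTimeUrn.map_restrict_history (hU : IsDiscreteTimeUrn P a b c d α β U)
    (n : ℕ) (u : Fin (n + 1) → ℕ × ℕ) :
    (P.restrict (history U n ⁻¹' {u})).map (U (n + 1)) =
      ENNReal.ofReal (P.real (history U n ⁻¹' {u}) *
        ((u (Fin.last n)).1 / (((u (Fin.last n)).1 : ℝ) + (u (Fin.last n)).2))) •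
          Measure.dirac (u (Fin.last n) + (a, b)) +
      ENNReal.ofReal (P.real (history U n ⁻¹' {u}) *
        ((u (Fin.last n)).2 / (((u (Fin.last n)).1 : ℝ) + (u (Fin.last n)).2))) •
          Measure.dirac (u (Fin.last n) + (c, d)) := by
  refine Measure.ext_of_singleton fun w => ?_
  rw [Measure.map_apply (hU.measurable _) (MeasurableSet.singleton w),
    Measure.restrict_apply (hU.measurable _ (MeasurableSet.singleton w)), Set.inter_comm,
    ← ofReal_measureReal, hU.measureReal_history_inter]
  set v := u (Fin.last n)
  have hp : 0 ≤ P.real (history U n ⁻¹' {u}) := measureReal_nonneg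
  simp only [Measure.add_apply, Measure.smul_apply, smul_eq_mul,
    Measure.dirac_apply' _ (MeasurableSet.singleton w)]
  rw [stepProb, mul_add, ENNReal.ofReal_add (by positivity) (by positivity)]
  congr 1
  · by_cases h : w = v + (a, b)
    · simp [h]
    · simp [h, Ne.symm h]
  · by_cases h : w = v + (c, d)
    · simp [h]
    · simp [h, Ne.symm h]

theorem IsDiscreteTimeUrn.setIntegral_history (hU : IsDiscreteTimeUrn P a b c d α β U)
    (n : ℕ) (u : Fin (n + 1) → ℕ × ℕ) (g : ℕ × ℕ → ℝ) :
    ∫ ω in history U n ⁻¹' {u}, g (U (n + 1) ω) ∂P =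
      ∫ ω in history U n ⁻¹' {u}, drawMean a b c d g (U n ω) ∂P := by
  have hm : MeasurableSet (history U n ⁻¹' {u}) :=
    measurable_history hU.measurable n (MeasurableSet.singleton u)
  rw [setIntegral_congr_fun (f := fun ω => drawMean a b c d g (U n ω)) (g := fun _ => drawMean a b c d g (u (Fin.last n))) hm
    (fun ω hω => by
      have : history U n ω = u := hω
      simp only [← this, history_last])]
  rw [← integral_map (hU.measurable (n + 1)).aemeasurable
    (Measurable.of_discrete (f := g)).aestronglyMeasurable, hU.map_restrict_history,
    integral_add_measure
      ((integrable_dirac (by simp)).smul_measure ENNReal.ofReal_ne_top)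
      ((integrable_dirac (by simp)).smul_measure ENNReal.ofReal_ne_top),
    integral_smul_measure, integral_smul_measure, integral_dirac, integral_dirac,
    ENNReal.toReal_ofReal (by positivity), ENNReal.toReal_ofReal (by positivity),
    setIntegral_const, drawMean]
  simp only [smul_eq_mul]
  ring

theorem IsDiscreteTimeUrn.ae_step (hU : IsDiscreteTimeUrn P a b c d α β U) (n : ℕ) :
    ∀ᵐ ω ∂P, U (n + 1) ω = U n ω + (a, b) ∨ U (n + 1) ω = U n ω + (c, d) := by
  have h : ∀ (u : Fin (n + 1) → ℕ × ℕ) (w : ℕ × ℕ),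
      ∀ᵐ ω ∂P, history U n ω = u → U (n + 1) ω = w →
        w = u (Fin.last n) + (a, b) ∨ w = u (Fin.last n) + (c, d) := by
    intro u w
    by_cases hw : w = u (Fin.last n) + (a, b) ∨ w = u (Fin.last n) + (c, d)
    · exact ae_of_all _ fun _ _ _ => hw
    · have h0 : P (history U n ⁻¹' {u} ∩ U (n + 1) ⁻¹' {w}) = 0 := by
        rw [← measureReal_eq_zero_iff, hU.measureReal_history_inter]
        push Not at hw
        simp [stepProb, hw.1, hw.2]
      filter_upwards [measure_eq_zero_iff_ae_notMem.1 h0] with ω hω h1 h2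
      exact absurd ⟨h1, h2⟩ hω
  filter_upwards [ae_all_iff.2 fun u => ae_all_iff.2 (h u)] with ω hω
  have := hω (history U n ω) (U (n + 1) ω) rfl rfl
  rwa [history_last] at this

theorem IsDiscreteTimeUrn.ae_total (hU : IsDiscreteTimeUrn P a b c d α β U)
    (hbalance : a + b = c + d) (n : ℕ) :
    ∀ᵐ ω ∂P, (U n ω).1 + (U n ω).2 = α + β + n * (a + b) := by
  induction n with
  | zero =>
    filter_upwards [hU.initial] with ω hω
    simp [hω]
  | succ n ih =>
    filter_upwards [ih, hU.ae_step n] with ω h1 h2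
    rcases h2 with h2 | h2 <;> rw [h2] <;> simp only [Prod.fst_add, Prod.snd_add] <;>
      rw [Nat.succ_mul] <;> omega

/-- By balance the total at time `n` is deterministic, so only finitely many compositions are
possible. Every function of `U n` is therefore bounded, and integrability is free. -/
theorem IsDiscreteTimeUrn.exists_bound (hU : IsDiscreteTimeUrn P a b c d α β U)
    (hbalance : a + b = c + d) (n : ℕ) (g : ℕ × ℕ → ℝ) :
    ∃ C, ∀ᵐ ω ∂P, ‖g (U n ω)‖ ≤ C := by
  refine ⟨∑ v ∈ Finset.HasAntidiagonal.antidiagonal (α + β + n * (a + b)), ‖g v‖, ?_⟩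
  filter_upwards [hU.ae_total hbalance n] with ω hω
  exact Finset.single_le_sum (f := fun v => ‖g v‖) (fun _ _ => norm_nonneg _)
    (Finset.HasAntidiagonal.mem_antidiagonal.2 hω)

theorem IsDiscreteTimeUrn.integrable_comp (hU : IsDiscreteTimeUrn P a b c d α β U)
    (hbalance : a + b = c + d) (n : ℕ) (g : ℕ × ℕ → ℝ) : Integrable (fun ω => g (U n ω)) P := by
  obtain ⟨C, hC⟩ := hU.exists_bound hbalance n g
  exact Integrable.of_bound
    ((Measurable.of_discrete (f := g)).comp (hU.measurable n)).aestronglyMeasurable C hC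

/-- The Markov property of the urn, integrated over an event of the past. -/
theorem IsDiscreteTimeUrn.setIntegral_succ (hU : IsDiscreteTimeUrn P a b c d α β U)
    (hbalance : a + b = c + d) (n : ℕ) (g : ℕ × ℕ → ℝ) {s : Set Ω}
    (hs : MeasurableSet[historyFiltration hU.measurable n] s) :
    ∫ ω in s, g (U (n + 1) ω) ∂P = ∫ ω in s, drawMean a b c d g (U n ω) ∂P := by
  obtain ⟨B, -, rfl⟩ := hs
  have hB : history U n ⁻¹' B = ⋃ u : B, history U n ⁻¹' {(u : Fin (n + 1) → ℕ × ℕ)} := by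
    ext ω
    simp
  have hm : ∀ u : B, MeasurableSet (history U n ⁻¹' {(u : Fin (n + 1) → ℕ × ℕ)}) := fun u =>
    measurable_history hU.measurable n (MeasurableSet.singleton _)
  have hd : Pairwise (Function.onFun Disjoint
      fun u : B => history U n ⁻¹' {(u : Fin (n + 1) → ℕ × ℕ)}) := by
    intro u v huv
    refine Disjoint.preimage _ ?_
    simpa [Subtype.coe_inj] using huv
  rw [hB, integral_iUnion hm hd (hU.integrable_comp hbalance (n + 1) g).integrableOn,
    integral_iUnion hm hd (hU.integrable_comp hbalance n _).integrableOn]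
  exact tsum_congr fun u => hU.setIntegral_history n _ g

theorem IsDiscreteTimeUrn.integral_succ (hU : IsDiscreteTimeUrn P a b c d α β U)
    (hbalance : a + b = c + d) (n : ℕ) (g : ℕ × ℕ → ℝ) :
    ∫ ω, g (U (n + 1) ω) ∂P = ∫ ω, drawMean a b c d g (U n ω) ∂P := by
  have := hU.setIntegral_succ hbalance n g (s := Set.univ)
    (@MeasurableSet.univ _ (historyFiltration hU.measurable n))
  simpa using this

end Discrete

/-! ### A subgaussian estimate for one draw -/

/-- The linear term is kept apart because it averages to zero for a centred variable. Taylor's bound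
handles `|x| ≤ 1`; beyond, crude comparisons suffice. -/
theorem exp_le_add_exp_sq (x : ℝ) : Real.exp x ≤ x + Real.exp (x ^ 2) := by
  have h2 := Real.add_one_le_exp (x ^ 2)
  rcases le_or_gt |x| 1 with h | h
  · have := (abs_le.1 (Real.abs_exp_sub_one_sub_id_le h)).2
    linarith
  · rcases lt_abs.1 h with h | h
    · have : Real.exp x ≤ Real.exp (x ^ 2) := Real.exp_le_exp.2 (by nlinarith)
      linarith
    · have : Real.exp x ≤ 1 := Real.exp_le_one_iff.2 (by linarith)
      nlinarith

/-- The Laplace transform of a centred two-valued variable is subgaussian. -/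
theorem two_point_exp_le {p q : ℝ} (hp : 0 ≤ p) (hq : 0 ≤ q) (hpq : p + q = 1) (x : ℝ) :
    p * Real.exp (x * q) + q * Real.exp (-(x * p)) ≤ Real.exp (x ^ 2) := by
  have hq1 : q ^ 2 ≤ 1 := by nlinarith
  have hp1 : p ^ 2 ≤ 1 := by nlinarith
  have h1 : Real.exp (x * q) ≤ x * q + Real.exp (x ^ 2) := by
    refine (exp_le_add_exp_sq _).trans (add_le_add le_rfl (Real.exp_le_exp.2 ?_))
    rw [mul_pow]
    nlinarith [sq_nonneg x]
  have h2 : Real.exp (-(x * p)) ≤ -(x * p) + Real.exp (x ^ 2) := by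
    refine (exp_le_add_exp_sq _).trans (add_le_add le_rfl (Real.exp_le_exp.2 ?_))
    rw [neg_sq, mul_pow]
    nlinarith [sq_nonneg x]
  calc _ ≤ p * (x * q + Real.exp (x ^ 2)) + q * (-(x * p) + Real.exp (x ^ 2)) := by gcongr
    _ = (p + q) * Real.exp (x ^ 2) := by ring
    _ = _ := by rw [hpq, one_mul]

/-! ### The eigenform along one draw -/

section Ratio

variable {a b c d : ℕ}

theorem ratio_lt_one (hb : b ≠ 0) (hc : c ≠ 0) : ratio a b c < 1 := by
  have hb' : (0 : ℝ) < b := by exact_mod_cast Nat.pos_of_ne_zero hb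
  have hc' : (0 : ℝ) < c := by exact_mod_cast Nat.pos_of_ne_zero hc
  rw [ratio, div_lt_one (by positivity)]
  linarith

theorem ratio_mul (hb : b ≠ 0) : ratio a b c * ((a : ℝ) + b) = (a : ℝ) - c := by
  have hb' : (0 : ℝ) < b := by exact_mod_cast Nat.pos_of_ne_zero hb
  rw [ratio, div_mul_cancel₀ _ (by positivity)]

/-- With `u₂_add_right`, this splits a draw into drift and noise. The noise is `σ (b + c)` times `q`
or `-p`, taken with probabilities `p` and `q`, hence centred; `σ (b + c)` is the gap `u₂(a, b) -
u₂(c, d)`. -/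
theorem u₂_add_left (hb : b ≠ 0) {v : ℕ × ℕ} (hv : 0 < (v.1 : ℝ) + v.2) :
    u₂ a b c (v + (a, b)) = u₂ a b c v * (1 + ((a : ℝ) - c) / ((v.1 : ℝ) + v.2)) +
      ratio a b c * (b + c) * ((v.2 : ℝ) / ((v.1 : ℝ) + v.2)) := by
  have hb' : (0 : ℝ) < b := by exact_mod_cast Nat.pos_of_ne_zero hb
  have hS : (0 : ℝ) < (a : ℝ) + b := by positivity
  simp only [u₂, ratio, Prod.fst_add, Prod.snd_add, Nat.cast_add]
  field_simp
  ring

theorem u₂_add_right (hbalance : a + b = c + d) (hb : b ≠ 0) {v : ℕ × ℕ}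
    (hv : 0 < (v.1 : ℝ) + v.2) :
    u₂ a b c (v + (c, d)) = u₂ a b c v * (1 + ((a : ℝ) - c) / ((v.1 : ℝ) + v.2)) -
      ratio a b c * (b + c) * ((v.1 : ℝ) / ((v.1 : ℝ) + v.2)) := by
  have hb' : (0 : ℝ) < b := by exact_mod_cast Nat.pos_of_ne_zero hb
  have hS : (0 : ℝ) < (a : ℝ) + b := by positivity
  have hd : (d : ℝ) = a + b - c := by
    have : ((a + b : ℕ) : ℝ) = ((c + d : ℕ) : ℝ) := by rw [hbalance]
    push_cast at this
    linarith
  simp only [u₂, ratio, Prod.fst_add, Prod.snd_add, Nat.cast_add]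
  rw [hd]
  field_simp
  ring

theorem abs_u₂_le (hb : b ≠ 0) (v : ℕ × ℕ) :
    |u₂ a b c v| ≤ (b + c) / ((a : ℝ) + b) * ((v.1 : ℝ) + v.2) := by
  have hb' : (0 : ℝ) < b := by exact_mod_cast Nat.pos_of_ne_zero hb
  have hS : (0 : ℝ) < (a : ℝ) + b := by positivity
  rw [u₂, abs_div, abs_of_pos hS, div_mul_eq_mul_div]
  gcongr
  have h1 : (0 : ℝ) ≤ (b : ℝ) * v.1 := by positivity
  have h2 : (0 : ℝ) ≤ (c : ℝ) * v.2 := by positivity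
  have h3 : (0 : ℝ) ≤ (b : ℝ) * v.2 := by positivity
  have h4 : (0 : ℝ) ≤ (c : ℝ) * v.1 := by positivity
  rw [abs_le]
  constructor <;> nlinarith

/-- The factor by which the mean of `u₂` grows during the first `n` draws. -/
noncomputable def urnGrowth (a b c α β : ℕ) (n : ℕ) : ℝ :=
  growth (((α : ℝ) + β) / ((a : ℝ) + b)) (ratio a b c) n

theorem urnGrowth_succ (hb : b ≠ 0) (α β n : ℕ) :
    urnGrowth a b c α β (n + 1) =
      urnGrowth a b c α β n *
        (1 + ((a : ℝ) - c) / ((α + β + n * (a + b) : ℕ) : ℝ)) := by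
  have hb' : (0 : ℝ) < b := by exact_mod_cast Nat.pos_of_ne_zero hb
  have hS : (0 : ℝ) < (a : ℝ) + b := by positivity
  have h : ((α + β + n * (a + b) : ℕ) : ℝ) =
      (((α : ℝ) + β) / ((a : ℝ) + b) + n) * ((a : ℝ) + b) := by
    push_cast
    field_simp
  rw [urnGrowth, growth_succ, urnGrowth, h, ← ratio_mul hb, mul_div_mul_right _ _ hS.ne']

theorem cast_total_pos {α β : ℕ} (hαβ : (α, β) ≠ (0, 0)) (k : ℕ) :
    (0 : ℝ) < ((α + β + k : ℕ) : ℝ) := by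
  have : α + β + k ≠ 0 := by
    intro h
    apply hαβ
    rw [Prod.mk.injEq]
    omega
  exact_mod_cast Nat.pos_of_ne_zero this

theorem shape_pos (hb : b ≠ 0) {α β : ℕ} (hαβ : (α, β) ≠ (0, 0)) :
    0 < ((α : ℝ) + β) / ((a : ℝ) + b) := by
  have hb' : (0 : ℝ) < b := by exact_mod_cast Nat.pos_of_ne_zero hb
  have := cast_total_pos hαβ 0
  push_cast at this
  rw [add_zero] at this
  positivity

end Ratio

/-! ### The martingale and its Laplace transform -/

section Discrete

variable {Ω : Type*} [mΩ : MeasurableSpace Ω] {P : Measure Ω} [IsProbabilityMeasure P]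
  {a b c d α β : ℕ} {U : ℕ → Ω → ℕ × ℕ}

/-- The normalised eigenform `u₂ (U n) / urnGrowth n`. -/
noncomputable def normalized (a b c α β : ℕ) (U : ℕ → Ω → ℕ × ℕ) (n : ℕ) (ω : Ω) : ℝ :=
  u₂ a b c (U n ω) / urnGrowth a b c α β n

theorem IsDiscreteTimeUrn.martingale_normalized (hU : IsDiscreteTimeUrn P a b c d α β U)
    (hbalance : a + b = c + d) (hb : b ≠ 0) (hσ : 0 < ratio a b c) (hαβ : (α, β) ≠ (0, 0)) :
    Martingale (normalized a b c α β U) (historyFiltration hU.measurable) P := by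
  refine martingale_of_setIntegral_eq_succ (fun n => ?_)
    (fun n => hU.integrable_comp hbalance n (fun v => u₂ a b c v / urnGrowth a b c α β n)) ?_
  · refine Measurable.stronglyMeasurable ?_
    exact (Measurable.of_discrete (f := fun v => u₂ a b c v / urnGrowth a b c α β n)).comp
      (measurable_historyFiltration hU.measurable n)
  · intro n s hs
    have hγ : 0 < urnGrowth a b c α β n := growth_pos (shape_pos hb hαβ) hσ n
    have hγ' : 0 < urnGrowth a b c α β (n + 1) := growth_pos (shape_pos hb hαβ) hσ (n + 1)
    have hsucc := hU.setIntegral_succ hbalance n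
      (fun v => u₂ a b c v / urnGrowth a b c α β (n + 1)) hs
    refine Eq.trans ?_ hsucc.symm
    refine setIntegral_congr_ae ((historyFiltration hU.measurable).le n s hs) ?_
    filter_upwards [hU.ae_total hbalance n] with ω hω _
    have hT := cast_total_pos hαβ (n * (a + b))
    rw [urnGrowth_succ hb, ← hω] at hγ'
    have hstep := urnGrowth_succ (a := a) (c := c) hb α β n
    rw [← hω] at hT hstep
    push_cast at hT hstep hγ'
    rw [drawMean, u₂_add_left hb hT, u₂_add_right hbalance hb hT, hstep, normalized]
    have h1 : 0 < 1 + ((a : ℝ) - c) / (((U n ω).1 : ℝ) + (U n ω).2) :=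
      (mul_pos_iff_of_pos_left hγ).1 hγ'
    have h2 : ((U n ω).1 : ℝ) / (((U n ω).1 : ℝ) + (U n ω).2) +
        ((U n ω).2 : ℝ) / (((U n ω).1 : ℝ) + (U n ω).2) = 1 := by
      field_simp
    set p := ((U n ω).1 : ℝ) / (((U n ω).1 : ℝ) + (U n ω).2)
    set q := ((U n ω).2 : ℝ) / (((U n ω).1 : ℝ) + (U n ω).2)
    set r := 1 + ((a : ℝ) - c) / (((U n ω).1 : ℝ) + (U n ω).2)
    set x := u₂ a b c (U n ω)
    have h3 : x / urnGrowth a b c α β n = (p + q) * (x * r) / (urnGrowth a b c α β n * r) := by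
      rw [h2, one_mul, mul_div_mul_right _ _ h1.ne']
    rw [h3]
    ring

/-- Given the composition, the increment is a centred two-valued variable scaled by `σ (b + c) /
urnGrowth (n + 1)`, so `two_point_exp_le` bounds its Laplace transform. -/
theorem IsDiscreteTimeUrn.mgf_normalized_succ_le (hU : IsDiscreteTimeUrn P a b c d α β U)
    (hbalance : a + b = c + d) (hb : b ≠ 0) (hσ : 0 < ratio a b c) (hαβ : (α, β) ≠ (0, 0))
    (n : ℕ) (l : ℝ) :
    mgf (normalized a b c α β U (n + 1)) P l ≤
      Real.exp ((l * (ratio a b c * (b + c)) / urnGrowth a b c α β (n + 1)) ^ 2) *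
        mgf (normalized a b c α β U n) P l := by
  have hγ : 0 < urnGrowth a b c α β n := growth_pos (shape_pos hb hαβ) hσ n
  have hγ' : 0 < urnGrowth a b c α β (n + 1) := growth_pos (shape_pos hb hαβ) hσ (n + 1)
  have hsucc := hU.integral_succ hbalance n
    (fun v => Real.exp (l * (u₂ a b c v / urnGrowth a b c α β (n + 1))))
  rw [mgf, mgf, ← integral_const_mul]
  refine (le_of_eq hsucc).trans (integral_mono_ae (hU.integrable_comp hbalance n _)
    ((hU.integrable_comp hbalance n
      (fun v => Real.exp (l * (u₂ a b c v / urnGrowth a b c α β n)))).const_mul _) ?_)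
  filter_upwards [hU.ae_total hbalance n] with ω hω
  have hT := cast_total_pos hαβ (n * (a + b))
  have hstep := urnGrowth_succ (a := a) (c := c) hb α β n
  rw [← hω] at hT hstep
  push_cast at hT hstep
  rw [drawMean, u₂_add_left hb hT, u₂_add_right hbalance hb hT, normalized]
  have h1 : 0 < 1 + ((a : ℝ) - c) / (((U n ω).1 : ℝ) + (U n ω).2) := by
    rw [hstep] at hγ'
    exact (mul_pos_iff_of_pos_left hγ).1 hγ'
  have h2 : ((U n ω).1 : ℝ) / (((U n ω).1 : ℝ) + (U n ω).2) +
      ((U n ω).2 : ℝ) / (((U n ω).1 : ℝ) + (U n ω).2) = 1 := by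
    field_simp
  have hp : 0 ≤ ((U n ω).1 : ℝ) / (((U n ω).1 : ℝ) + (U n ω).2) := by positivity
  have hq : 0 ≤ ((U n ω).2 : ℝ) / (((U n ω).1 : ℝ) + (U n ω).2) := by positivity
  set p := ((U n ω).1 : ℝ) / (((U n ω).1 : ℝ) + (U n ω).2)
  set q := ((U n ω).2 : ℝ) / (((U n ω).1 : ℝ) + (U n ω).2)
  set r := 1 + ((a : ℝ) - c) / (((U n ω).1 : ℝ) + (U n ω).2)
  set x := u₂ a b c (U n ω)
  set γ := urnGrowth a b c α β n
  set γ' := urnGrowth a b c α β (n + 1)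
  set K := ratio a b c * (b + c)
  have h3 : x * r / γ' = x / γ := by rw [hstep, mul_div_mul_right _ _ h1.ne']
  have e1 : l * ((x * r + K * q) / γ') = l * (x / γ) + l * K / γ' * q := by
    rw [← h3]; ring
  have e2 : l * ((x * r - K * p) / γ') = l * (x / γ) + -(l * K / γ' * p) := by
    rw [← h3]; ring
  rw [e1, e2, Real.exp_add, Real.exp_add]
  have := two_point_exp_le hp hq h2 (l * K / γ')
  have hx := Real.exp_pos (l * (x / γ))
  calc _ = (p * Real.exp (l * K / γ' * q) + q * Real.exp (-(l * K / γ' * p))) *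
        Real.exp (l * (x / γ)) := by ring
    _ ≤ _ := by gcongr

theorem IsDiscreteTimeUrn.mgf_normalized_le (hU : IsDiscreteTimeUrn P a b c d α β U)
    (hbalance : a + b = c + d) (hb : b ≠ 0) (hσ : 0 < ratio a b c) (hαβ : (α, β) ≠ (0, 0))
    {N n : ℕ} (hn : N ≤ n) (l : ℝ) :
    mgf (normalized a b c α β U n) P l ≤
      Real.exp (∑ k ∈ Finset.Ico N n,
        (l * (ratio a b c * (b + c)) / urnGrowth a b c α β (k + 1)) ^ 2) *
        mgf (normalized a b c α β U N) P l := by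
  induction n, hn using Nat.le_induction with
  | base => simp
  | succ n hn ih =>
    refine (hU.mgf_normalized_succ_le hbalance hb hσ hαβ n l).trans ?_
    rw [Finset.sum_Ico_succ_top hn, Real.exp_add, mul_right_comm, mul_comm]
    gcongr

/-- A deterministic bound: `u₂` is at most linear in the number of balls, which is `O(N)`, while the
normalisation is at least `κ N ^ σ`. -/
theorem IsDiscreteTimeUrn.exists_abs_normalized_le (hU : IsDiscreteTimeUrn P a b c d α β U)
    (hbalance : a + b = c + d) (hb : b ≠ 0) (hσ : 0 < ratio a b c) (hαβ : (α, β) ≠ (0, 0)) :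
    ∃ B > 0, ∀ N : ℕ, 1 ≤ N →
      ∀ᵐ ω ∂P, |normalized a b c α β U N ω| ≤ B * (N : ℝ) ^ (1 - ratio a b c) := by
  obtain ⟨κ, hκ, hgrowth⟩ := exists_rpow_le_growth (shape_pos (a := a) hb hαβ) hσ
  have hb' : (0 : ℝ) < b := by exact_mod_cast Nat.pos_of_ne_zero hb
  have hS : (0 : ℝ) < (a : ℝ) + b := by positivity
  refine ⟨(b + c) / ((a : ℝ) + b) * (α + β + (a + b)) / κ, by positivity, fun N hN => ?_⟩
  filter_upwards [hU.ae_total hbalance N] with ω hω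
  have hN1 : (1 : ℝ) ≤ N := by exact_mod_cast hN
  have hN0 : (0 : ℝ) < N := by linarith
  have hpow : 0 < (N : ℝ) ^ ratio a b c := Real.rpow_pos_of_pos hN0 _
  have hg : κ * (N : ℝ) ^ ratio a b c ≤ urnGrowth a b c α β N := hgrowth N
  have hg0 : 0 < κ * (N : ℝ) ^ ratio a b c := by positivity
  have hω' : ((U N ω).1 : ℝ) + (U N ω).2 = α + β + N * (a + b) := by exact_mod_cast hω
  rw [normalized, abs_div, abs_of_pos (hg0.trans_le hg), Real.rpow_sub hN0, Real.rpow_one]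
  calc |u₂ a b c (U N ω)| / urnGrowth a b c α β N
      ≤ ((b + c) / ((a : ℝ) + b) * ((α + β + (a + b)) * N)) / (κ * (N : ℝ) ^ ratio a b c) := by
        gcongr
        refine (abs_u₂_le hb _).trans ?_
        rw [hω']
        gcongr
        nlinarith [(Nat.cast_nonneg α : (0 : ℝ) ≤ α), (Nat.cast_nonneg β : (0 : ℝ) ≤ β)]
    _ = _ := by field_simp

/-- The Laplace transform of the martingale at the scale `N ^ σ`. -/
theorem IsDiscreteTimeUrn.exists_mgf_normalized_le (hU : IsDiscreteTimeUrn P a b c d α β U)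
    (hbalance : a + b = c + d) (hb : b ≠ 0) (hσ : 1 / 2 < ratio a b c) (hαβ : (α, β) ≠ (0, 0)) :
    ∃ D > 0, ∀ N n : ℕ, 1 ≤ N → N ≤ n → ∀ l : ℝ, |l| = (N : ℝ) ^ ratio a b c →
      mgf (normalized a b c α β U n) P l ≤ Real.exp (D * N) := by
  have hσ0 : 0 < ratio a b c := by linarith
  obtain ⟨B, hB, hbound⟩ := hU.exists_abs_normalized_le hbalance hb hσ0 hαβ
  obtain ⟨κ, hκ, hgrowth⟩ := exists_rpow_le_growth (shape_pos (a := a) hb hαβ) hσ0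
  have hb' : (0 : ℝ) < b := by exact_mod_cast Nat.pos_of_ne_zero hb
  set K := ratio a b c * (b + c) with hK
  have hρ : 0 < 2 * ratio a b c - 1 := by linarith
  -- The first term pays for the increments after time `N`, the second for the position at time `N`.
  refine ⟨(K / κ) ^ 2 / (2 * ratio a b c - 1) + B, by positivity, fun N n hN hn l hl => ?_⟩
  have hN0 : (0 : ℝ) < N := by exact_mod_cast hN
  refine (hU.mgf_normalized_le hbalance hb hσ0 hαβ hn l).trans ?_
  rw [add_mul, Real.exp_add]
  refine mul_le_mul (Real.exp_le_exp.2 ?_) ?_ mgf_nonneg (Real.exp_pos _).le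
  · calc ∑ k ∈ Finset.Ico N n, (l * K / urnGrowth a b c α β (k + 1)) ^ 2
        ≤ ∑ k ∈ Finset.Ico N n, (l ^ 2 * (K / κ) ^ 2) *
            (((k + 1 : ℕ) : ℝ) ^ ratio a b c)⁻¹ ^ 2 := by
          refine Finset.sum_le_sum fun k _ => ?_
          have hg : κ * ((k + 1 : ℕ) : ℝ) ^ ratio a b c ≤ urnGrowth a b c α β (k + 1) :=
            hgrowth (k + 1)
          have hpow : 0 < ((k + 1 : ℕ) : ℝ) ^ ratio a b c :=
            Real.rpow_pos_of_pos (by positivity) _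
          rw [div_pow, mul_pow]
          calc l ^ 2 * K ^ 2 / urnGrowth a b c α β (k + 1) ^ 2
              ≤ l ^ 2 * K ^ 2 / (κ * ((k + 1 : ℕ) : ℝ) ^ ratio a b c) ^ 2 := by gcongr
            _ = _ := by field_simp
      _ ≤ (l ^ 2 * (K / κ) ^ 2) *
            ((N : ℝ) ^ (1 - 2 * ratio a b c) / (2 * ratio a b c - 1)) := by
          rw [← Finset.mul_sum]
          gcongr
          exact sum_Ico_rpow_neg_le hσ hN hn
      _ = (K / κ) ^ 2 / (2 * ratio a b c - 1) * (l ^ 2 * (N : ℝ) ^ (1 - 2 * ratio a b c)) := by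
          ring
      _ = _ := by
          -- The scale `|l| = N ^ σ` is chosen so that this contribution is also linear in `N`.
          have : l ^ 2 * (N : ℝ) ^ (1 - 2 * ratio a b c) = N := by
            rw [← sq_abs, hl, ← Real.rpow_natCast, ← Real.rpow_mul hN0.le, ← Real.rpow_add hN0]
            have : ratio a b c * ((2 : ℕ) : ℝ) + (1 - 2 * ratio a b c) = 1 := by
              push_cast
              ring
            rw [this, Real.rpow_one]
          rw [this]
  · calc mgf (normalized a b c α β U N) P l ≤ ∫ _, Real.exp (B * N) ∂P := by
          refine integral_mono_ae (hU.integrable_comp hbalance N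
            (fun v => Real.exp (l * (u₂ a b c v / urnGrowth a b c α β N))))
            (integrable_const _) ?_
          filter_upwards [hbound N hN] with ω hω
          refine Real.exp_le_exp.2 ((le_abs_self _).trans ?_)
          rw [abs_mul, hl]
          calc (N : ℝ) ^ ratio a b c * |normalized a b c α β U N ω|
              ≤ (N : ℝ) ^ ratio a b c * (B * (N : ℝ) ^ (1 - ratio a b c)) := by gcongr
            _ = B * ((N : ℝ) ^ ratio a b c * (N : ℝ) ^ (1 - ratio a b c)) := by ring
            _ = B * N := by
              rw [← Real.rpow_add hN0, add_sub_cancel, Real.rpow_one]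
      _ = _ := by simp

end Discrete

/-! ### The discrete-time limit and its tail -/

/-- Tail bounds pass to almost sure limits. -/
theorem measureReal_lt_limit_le {Ω : Type*} [MeasurableSpace Ω] {P : Measure Ω}
    [IsProbabilityMeasure P] {X : ℕ → Ω → ℝ} {L : Ω → ℝ}
    (hlim : ∀ᵐ ω ∂P, Tendsto (fun n => X n ω) atTop (𝓝 (L ω))) {y t : ℝ} {N : ℕ}
    (h : ∀ n, N ≤ n → P.real {ω | y ≤ X n ω} ≤ t) : P.real {ω | y < L ω} ≤ t := by
  have ht : 0 ≤ t := measureReal_nonneg.trans (h N le_rfl)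
  -- A limit strictly above `y` forces `y ≤ X n` eventually, so the event lies almost surely in the
  -- increasing union of the `A j`, each bounded by a single term.
  set A : ℕ → Set Ω := fun j => ⋂ n ≥ max N j, {ω | y ≤ X n ω}
  have hmono : Monotone A := by
    intro i j hij ω hω
    simp only [A, Set.mem_iInter] at hω ⊢
    exact fun n hn => hω n ((max_le_max le_rfl hij).trans hn)
  have hA : ∀ j, P (A j) ≤ ENNReal.ofReal t := by
    intro j
    refine (measure_mono (Set.iInter₂_subset (max N j) le_rfl)).trans ?_
    rw [← ofReal_measureReal]
    exact ENNReal.ofReal_le_ofReal (h _ (le_max_left _ _))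
  refine ENNReal.toReal_le_of_le_ofReal ht ?_
  calc P {ω | y < L ω} ≤ P (⋃ j, A j) := by
        refine measure_mono_ae ?_
        filter_upwards [hlim] with ω hω hy
        obtain ⟨j, hj⟩ := eventually_atTop.1 (hω.eventually_const_lt hy)
        refine Set.mem_iUnion.2 ⟨j, ?_⟩
        simp only [A, Set.mem_iInter]
        exact fun n hn => (hj n ((le_max_right _ _).trans hn)).le
    _ = ⨆ j, P (A j) := hmono.measure_iUnion
    _ ≤ _ := iSup_le hA

section Discrete

variable {Ω : Type*} [mΩ : MeasurableSpace Ω] {P : Measure Ω} [IsProbabilityMeasure P]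
  {a b c d α β : ℕ} {U : ℕ → Ω → ℕ × ℕ}

theorem measurable_normalized (hU : ∀ n, Measurable (U n)) (n : ℕ) :
    Measurable (normalized a b c α β U n) :=
  (Measurable.of_discrete (f := fun v => u₂ a b c v / urnGrowth a b c α β n)).comp (hU n)

theorem IsDiscreteTimeUrn.integrable_normalized (hU : IsDiscreteTimeUrn P a b c d α β U)
    (hbalance : a + b = c + d) (n : ℕ) : Integrable (normalized a b c α β U n) P :=
  hU.integrable_comp hbalance n fun v => u₂ a b c v / urnGrowth a b c α β n

theorem IsDiscreteTimeUrn.exists_tail_normalized (hU : IsDiscreteTimeUrn P a b c d α β U)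
    (hbalance : a + b = c + d) (hb : b ≠ 0) (hσ : 1 / 2 < ratio a b c) (hαβ : (α, β) ≠ (0, 0)) :
    ∃ K > 0, ∀ N n : ℕ, 1 ≤ N → N ≤ n →
      P.real {ω | K * (N : ℝ) ^ (1 - ratio a b c) ≤ |normalized a b c α β U n ω|} ≤
        2 * Real.exp (-1 * N) := by
  obtain ⟨D, hD, hmgf⟩ := hU.exists_mgf_normalized_le hbalance hb hσ hαβ
  -- In Chernoff's bound with `l = N ^ σ`, the level `D + 1` beats the factor `exp(D N)` by
  -- `exp(-N)`.
  refine ⟨D + 1, by positivity, fun N n hN hn => ?_⟩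
  have hN0 : (0 : ℝ) < N := by exact_mod_cast hN
  set y := (D + 1) * (N : ℝ) ^ (1 - ratio a b c)
  set l := (N : ℝ) ^ ratio a b c
  have hl : 0 ≤ l := by positivity
  have hly : l * y = (D + 1) * N := by
    calc l * y = (D + 1) * ((N : ℝ) ^ ratio a b c * (N : ℝ) ^ (1 - ratio a b c)) := by ring
      _ = _ := by rw [← Real.rpow_add hN0, add_sub_cancel, Real.rpow_one]
  have hint : ∀ l : ℝ, Integrable (fun ω => Real.exp (l * normalized a b c α β U n ω)) P :=
    fun l => hU.integrable_comp hbalance n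
      (fun v => Real.exp (l * (u₂ a b c v / urnGrowth a b c α β n)))
  have hexp : Real.exp (-(l * y)) * Real.exp (D * N) = Real.exp (-1 * N) := by
    rw [← Real.exp_add, hly]
    congr 1
    ring
  have h1 : P.real {ω | y ≤ normalized a b c α β U n ω} ≤ Real.exp (-1 * N) := by
    refine (measure_ge_le_exp_mul_mgf y hl (hint l)).trans ?_
    rw [← hexp, neg_mul]
    gcongr
    exact hmgf N n hN hn l (abs_of_nonneg hl)
  have h2 : P.real {ω | normalized a b c α β U n ω ≤ -y} ≤ Real.exp (-1 * N) := by
    refine (measure_le_le_exp_mul_mgf (-y) (neg_nonpos.2 hl) (hint (-l))).trans ?_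
    rw [← hexp, show - -l * -y = -(l * y) by ring]
    gcongr
    exact hmgf N n hN hn (-l) (by rw [abs_neg, abs_of_nonneg hl])
  calc _ ≤ P.real ({ω | y ≤ normalized a b c α β U n ω} ∪
        {ω | normalized a b c α β U n ω ≤ -y}) := by
        refine measureReal_mono fun ω hω => ?_
        rcases le_abs.1 (show y ≤ |normalized a b c α β U n ω| from hω) with h | h
        · exact Or.inl h
        · exact Or.inr (show normalized a b c α β U n ω ≤ -y by linarith)
    _ ≤ _ := measureReal_union_le _ _
    _ ≤ _ := by linarith

/-- The `L¹` bound needed for martingale convergence, from `|x| ≤ exp x + exp(-x)`. -/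
theorem IsDiscreteTimeUrn.exists_eLpNorm_normalized_le
    (hU : IsDiscreteTimeUrn P a b c d α β U) (hbalance : a + b = c + d) (hb : b ≠ 0)
    (hσ : 1 / 2 < ratio a b c) (hαβ : (α, β) ≠ (0, 0)) :
    ∃ R : ℝ≥0, ∀ n, eLpNorm (normalized a b c α β U n) 1 P ≤ R := by
  obtain ⟨D, hD, hmgf⟩ := hU.exists_mgf_normalized_le hbalance hb hσ hαβ
  obtain ⟨C, hC⟩ := hU.exists_bound hbalance 0 (fun v => u₂ a b c v / urnGrowth a b c α β 0)
  refine ⟨(max C (2 * Real.exp D)).toNNReal, fun n => ?_⟩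
  have hnorm : eLpNorm (normalized a b c α β U n) 1 P =
      ENNReal.ofReal (∫ ω, ‖normalized a b c α β U n ω‖ ∂P) := by
    rw [eLpNorm_one_eq_lintegral_enorm, ofReal_integral_norm_eq_lintegral_enorm
      (hU.integrable_normalized hbalance n)]
  rw [hnorm]
  refine ENNReal.ofReal_le_ofReal ?_
  rcases Nat.eq_zero_or_pos n with rfl | hn
  · refine le_trans ?_ (le_max_left _ _)
    calc _ ≤ ∫ _, C ∂P := integral_mono_ae
          (hU.integrable_normalized hbalance 0).norm
          (integrable_const _) hC
      _ = C := by simp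
  · refine le_trans ?_ (le_max_right _ _)
    have hint : ∀ l : ℝ, Integrable (fun ω => Real.exp (l * normalized a b c α β U n ω)) P :=
      fun l => hU.integrable_comp hbalance n
        (fun v => Real.exp (l * (u₂ a b c v / urnGrowth a b c α β n)))
    -- At `N = 1` the admissible scale is `|l| = 1 ^ σ = 1`.
    have e1 := hmgf 1 n le_rfl hn 1 (by simp)
    have e2 := hmgf 1 n le_rfl hn (-1) (by simp)
    simp only [Nat.cast_one, mul_one] at e1 e2
    calc _ ≤ ∫ ω, (Real.exp (1 * normalized a b c α β U n ω) +
          Real.exp (-1 * normalized a b c α β U n ω)) ∂P := by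
          refine integral_mono
            (hU.integrable_normalized hbalance n).norm
            ((hint 1).add (hint (-1))) fun ω => ?_
          set x := normalized a b c α β U n ω
          have h1 := Real.add_one_le_exp (1 * x)
          have h2 := Real.add_one_le_exp (-1 * x)
          have h3 := Real.exp_pos (1 * x)
          have h4 := Real.exp_pos (-1 * x)
          change |x| ≤ Real.exp (1 * x) + Real.exp (-1 * x)
          rw [abs_le]
          constructor <;> linarith
      _ = mgf (normalized a b c α β U n) P 1 + mgf (normalized a b c α β U n) P (-1) :=
          integral_add (hint 1) (hint (-1))
      _ ≤ _ := by linarith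

/-- The discrete-time urn has a limit, whose tail decays like `exp (-x ^ (1 / (1 - σ)))`. -/
theorem IsDiscreteTimeUrn.exists_limit (hU : IsDiscreteTimeUrn P a b c d α β U)
    (hbalance : a + b = c + d) (hb : b ≠ 0) (hσ : 1 / 2 < ratio a b c) (hαβ : (α, β) ≠ (0, 0)) :
    ∃ W : Ω → ℝ, IsDiscreteTimeLimit P a b c U W ∧ ∃ K > 0, ∀ N : ℕ, 1 ≤ N →
      P.real {ω | K * (N : ℝ) ^ (1 - ratio a b c) < |W ω|} ≤ 2 * Real.exp (-1 * N) := by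
  have hσ0 : 0 < ratio a b c := by linarith
  obtain ⟨R, hR⟩ := hU.exists_eLpNorm_normalized_le hbalance hb hσ hαβ
  obtain ⟨K, hK, htail⟩ := hU.exists_tail_normalized hbalance hb hσ hαβ
  obtain ⟨M, hM, hlim⟩ := measurable_limit_of_tendsto_metrizable_ae
    (fun n => (measurable_normalized hU.measurable n).aemeasurable)
    ((hU.martingale_normalized hbalance hb hσ0 hαβ).submartingale.exists_ae_tendsto_of_bdd hR)
  set s := ((α : ℝ) + β) / ((a : ℝ) + b)
  have hs : 0 < s := shape_pos hb hαβ
  set G := Real.Gamma s / Real.Gamma (s + ratio a b c)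
  have hG : 0 < G := div_pos (Real.Gamma_pos_of_pos hs) (Real.Gamma_pos_of_pos (by positivity))
  -- `G` is the limit of `growth n / n ^ σ`; it converts one normalisation into the other.
  refine ⟨fun ω => G * M ω, ⟨hM.const_mul _, ?_⟩, G * K, by positivity, fun N hN => ?_⟩
  · filter_upwards [hlim] with ω hω
    refine ((tendsto_growth_div_rpow hs hσ0).mul hω).congr fun n => ?_
    have : growth s (ratio a b c) n ≠ 0 := (growth_pos hs hσ0 n).ne'
    rw [normalized, urnGrowth]
    change growth s (ratio a b c) n / _ * (u₂ a b c (U n ω) / growth s (ratio a b c) n) = _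
    field_simp
  · have habs : ∀ᵐ ω ∂P,
        Tendsto (fun n => |normalized a b c α β U n ω|) atTop (𝓝 |M ω|) := by
      filter_upwards [hlim] with ω hω using hω.abs
    refine le_trans (le_of_eq ?_)
      (measureReal_lt_limit_le habs (N := N) fun n hn => htail N n hN hn)
    congr 1
    ext ω
    simp only [Set.mem_ofPred_eq, abs_mul, abs_of_pos hG, mul_assoc]
    exact mul_lt_mul_iff_right₀ hG

theorem IsDiscreteTimeUrn.exists_limit_isDeterminedByMoments
    (hU : IsDiscreteTimeUrn P a b c d α β U) (hbalance : a + b = c + d) (hb : b ≠ 0)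
    (hσ : 1 / 2 < ratio a b c) (hαβ : (α, β) ≠ (0, 0)) :
    ∃ W : Ω → ℝ, IsDiscreteTimeLimit P a b c U W ∧ IsDeterminedByMoments (P.map W) := by
  obtain ⟨W, hW, K, hK, htail⟩ := hU.exists_limit hbalance hb hσ hαβ
  refine ⟨W, hW, isDeterminedByMoments_map_of_tail P hW.1 hK one_pos (C := 2) fun N hN => ?_⟩
  refine le_trans (measureReal_mono fun ω (hω : K * N < |W ω|) => ?_) (htail N hN)
  refine lt_of_le_of_lt (b := K * N) ?_ hω
  have hN1 : (1 : ℝ) ≤ N := by exact_mod_cast hN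
  gcongr
  calc (N : ℝ) ^ (1 - ratio a b c) ≤ (N : ℝ) ^ (1 : ℝ) :=
        Real.rpow_le_rpow_of_exponent_le hN1 (by linarith)
    _ = N := Real.rpow_one _

end Discrete

/-! ### Independent exponential clocks -/

theorem expMeasure_singleton {r : ℝ} (x : ℝ) : expMeasure r {x} = 0 :=
  withDensity_absolutelyContinuous _ _ (measure_singleton x)

/-- The Laplace transform of the exponential law. -/
theorem integral_exp_neg_expMeasure {r s : ℝ} (hr : 0 < r) (hs : 0 ≤ s) :
    ∫ x, Real.exp (-s * x) ∂(expMeasure r) = r / (r + s) := by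
  have hpt : ∀ x, exponentialPDF r x * ENNReal.ofReal (Real.exp (-s * x)) =
      ENNReal.ofReal (r / (r + s)) * exponentialPDF (r + s) x := by
    intro x
    rcases lt_or_ge x 0 with h | h
    · simp [exponentialPDF_of_neg h]
    · rw [exponentialPDF_of_nonneg h, exponentialPDF_of_nonneg h,
        ← ENNReal.ofReal_mul (by positivity), ← ENNReal.ofReal_mul (by positivity), mul_assoc,
        ← Real.exp_add]
      congr 1
      have : r + s ≠ 0 := by positivity
      rw [← mul_assoc, div_mul_cancel₀ _ this]
      congr 2
      ring
  have hmeas : ∀ r, Measurable (exponentialPDF r) := fun r =>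
    (measurable_exponentialPDFReal r).ennreal_ofReal
  have hlin : ∫⁻ x, ENNReal.ofReal (Real.exp (-s * x)) ∂(expMeasure r) =
      ENNReal.ofReal (r / (r + s)) := by
    have : expMeasure r = volume.withDensity (exponentialPDF r) := rfl
    rw [this, lintegral_withDensity_eq_lintegral_mul _
      (hmeas r) (by fun_prop)]
    simp only [Pi.mul_apply, hpt]
    rw [lintegral_const_mul _ (hmeas (r + s)),
      lintegral_exponentialPDF_eq_one (by positivity), mul_one]
  rw [integral_eq_lintegral_of_nonneg_ae (ae_of_all _ fun _ => (Real.exp_pos _).le)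
    (by fun_prop), hlin, ENNReal.toReal_ofReal (by positivity)]

theorem expMeasure_real_Ioi {r : ℝ} (hr : 0 < r) (x : ℝ) :
    (expMeasure r).real (Set.Ioi x) = if 0 ≤ x then Real.exp (-(r * x)) else 1 := by
  have := isProbabilityMeasure_expMeasure hr
  rw [← Set.compl_Iic, probReal_compl_eq_one_sub measurableSet_Iic, ← cdf_eq_real,
    cdf_expMeasure_eq hr]
  split_ifs <;> ring

section Clocks

variable {Ω : Type*} [MeasurableSpace Ω] {P : Measure Ω} [IsProbabilityMeasure P]
  {T : ℕ} {E : Fin T → Ω → ℝ}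

theorem ae_nonneg_of_map_expMeasure {X : Ω → ℝ} (hX : Measurable X)
    (hexp : P.map X = expMeasure 1) : ∀ᵐ ω ∂P, 0 ≤ X ω := by
  have h0 : P.real (X ⁻¹' Set.Ioi (0 : ℝ)) = 1 := by
    rw [← map_measureReal_apply hX measurableSet_Ioi, hexp, expMeasure_real_Ioi one_pos]
    simp
  have h1 : ∀ᵐ ω ∂P, ω ∈ X ⁻¹' Set.Ioi (0 : ℝ) := by
    have h2 : P.real (X ⁻¹' Set.Ioi (0 : ℝ))ᶜ = 0 := by
      rw [probReal_compl_eq_one_sub (hX measurableSet_Ioi), h0, sub_self]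
    exact (measureReal_eq_zero_iff).1 h2
  filter_upwards [h1] with ω hω using le_of_lt hω

theorem measurable_iInf_clocks (hm : ∀ j, Measurable (E j)) :
    Measurable fun ω => ⨅ j, E j ω := Measurable.iInf hm

/-- The first ring among `T` independent exponential clocks of parameter `1` is exponential of
parameter `T`. -/
theorem map_iInf_clocks (hT : 0 < T) (hm : ∀ j, Measurable (E j))
    (hexp : ∀ j, P.map (E j) = expMeasure 1) (hind : iIndepFun E P) :
    P.map (fun ω => ⨅ j, E j ω) = expMeasure T := by
  have hT' : (0 : ℝ) < T := by exact_mod_cast hT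
  have : Nonempty (Fin T) := ⟨⟨0, hT⟩⟩
  have hmin := measurable_iInf_clocks hm
  have := isProbabilityMeasure_expMeasure hT'
  have : IsProbabilityMeasure (P.map fun ω => ⨅ j, E j ω) :=
    Measure.isProbabilityMeasure_map hmin.aemeasurable
  refine Measure.eq_of_cdf _ _ ?_
  ext x
  have hset : (fun ω => ⨅ j, E j ω) ⁻¹' Set.Ioi x = ⋂ j ∈ Finset.univ, E j ⁻¹' Set.Ioi x := by
    ext ω
    simp only [Set.mem_preimage, Set.mem_Ioi, Set.mem_iInter, Finset.mem_univ, true_imp_iff]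
    constructor
    · intro h j
      exact h.trans_le (ciInf_le (Set.finite_range _).bddBelow j)
    · intro h
      obtain ⟨j, hj⟩ := exists_eq_ciInf_of_finite (f := fun j => E j ω)
      rw [← hj]
      exact h j
  have key : (P.map fun ω => ⨅ j, E j ω).real (Set.Ioi x) =
      (expMeasure T).real (Set.Ioi x) := by
    rw [map_measureReal_apply hmin measurableSet_Ioi, hset, measureReal_def,
      hind.measure_inter_preimage_eq_mul Finset.univ (fun _ _ => measurableSet_Ioi),
      ENNReal.toReal_prod]
    have hj : ∀ j, (P (E j ⁻¹' Set.Ioi x)).toReal = if 0 ≤ x then Real.exp (-x) else 1 := by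
      intro j
      rw [← Measure.map_apply (hm j) measurableSet_Ioi, hexp j, ← measureReal_def,
        expMeasure_real_Ioi one_pos, one_mul]
    simp only [hj]
    rw [expMeasure_real_Ioi hT', Finset.prod_const, Finset.card_univ, Fintype.card_fin]
    split_ifs
    · rw [← Real.exp_nat_mul]
      congr 1
      ring
    · simp
  rw [← Set.compl_Iic, probReal_compl_eq_one_sub measurableSet_Iic,
    probReal_compl_eq_one_sub measurableSet_Iic] at key
  rw [cdf_eq_real, cdf_eq_real]
  linarith

theorem integral_exp_neg_iInf_clocks (hT : 0 < T) (hm : ∀ j, Measurable (E j))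
    (hexp : ∀ j, P.map (E j) = expMeasure 1) (hind : iIndepFun E P) {s : ℝ} (hs : 0 ≤ s) :
    ∫ ω, Real.exp (-s * ⨅ j, E j ω) ∂P = T / (T + s) := by
  rw [← integral_exp_neg_expMeasure (by exact_mod_cast hT) hs, ← map_iInf_clocks hT hm hexp hind,
    integral_map (measurable_iInf_clocks hm).aemeasurable (by fun_prop)]

/-- The set of configurations in which the clock `j` rings first. -/
def ringsFirst {T : ℕ} (j : Fin T) : Set (Fin T → ℝ) := {x | ∀ i, x j ≤ x i}

theorem measurableSet_ringsFirst (j : Fin T) : MeasurableSet (ringsFirst j) := by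
  have : ringsFirst j = ⋂ i, {x : Fin T → ℝ | x j ≤ x i} := by
    ext x
    simp [ringsFirst]
  rw [this]
  exact MeasurableSet.iInter fun i =>
    measurableSet_le (measurable_pi_apply j) (measurable_pi_apply i)

/-- Exchangeability: swapping two coordinates preserves the product measure and exchanges the two
events. -/
theorem pi_ringsFirst_eq {μ : Measure ℝ} [SigmaFinite μ] (i j : Fin T) :
    Measure.pi (fun _ : Fin T => μ) (ringsFirst i) =
      Measure.pi (fun _ : Fin T => μ) (ringsFirst j) := by
  have h := measurePreserving_piCongrLeft (fun _ : Fin T => μ) (Equiv.swap i j)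
  rw [← h.measure_preimage (measurableSet_ringsFirst j).nullMeasurableSet]
  congr 1
  ext x
  have hx : ∀ k, (MeasurableEquiv.piCongrLeft (fun _ : Fin T => ℝ) (Equiv.swap i j)) x k =
      x (Equiv.swap i j k) := by
    intro k
    have := Equiv.piCongrLeft_apply_apply (fun _ : Fin T => ℝ) (Equiv.swap i j) x
      (Equiv.swap i j k)
    rw [Equiv.swap_apply_self] at this
    exact this
  simp only [ringsFirst, Set.mem_preimage, Set.mem_ofPred_eq, hx, Equiv.swap_apply_right]
  exact ((Equiv.swap i j).forall_congr_left (p := fun k => x i ≤ x k)).trans (by simp)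

theorem clocks_ne_ae (hm : ∀ j, Measurable (E j))
    (hexp : ∀ j, P.map (E j) = expMeasure 1) (hind : iIndepFun E P) {i j : Fin T} (hij : i ≠ j) :
    P {ω | E i ω = E j ω} = 0 := by
  have h1 := (indepFun_iff_map_prod_eq_prod_map_map (hm i).aemeasurable
    (hm j).aemeasurable).1 (hind.indepFun hij)
  have := isProbabilityMeasure_expMeasure one_pos
  have h2 : P {ω | E i ω = E j ω} = (P.map fun ω => (E i ω, E j ω)) {p | p.1 = p.2} := by
    rw [Measure.map_apply ((hm i).prodMk (hm j))
      (measurableSet_eq_fun measurable_fst measurable_snd)]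
    rfl
  rw [h2, h1, hexp, hexp,
    Measure.measure_prod_null (measurableSet_eq_fun measurable_fst measurable_snd)]
  refine ae_of_all _ fun x => ?_
  have : Prod.mk x ⁻¹' {p : ℝ × ℝ | p.1 = p.2} = {x} := by
    ext y
    simp [eq_comm]
  change expMeasure 1 (Prod.mk x ⁻¹' {p : ℝ × ℝ | p.1 = p.2}) = 0
  rw [this]
  exact expMeasure_singleton x

/-- The clock that rings first is uniformly distributed. -/
theorem measureReal_exists_ringsFirst (hT : 0 < T) (hm : ∀ j, Measurable (E j))
    (hexp : ∀ j, P.map (E j) = expMeasure 1) (hind : iIndepFun E P) (J : Finset (Fin T)) :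
    P.real {ω | ∃ j ∈ J, ∀ i, E j ω ≤ E i ω} = J.card / T := by
  have hT' : (0 : ℝ) < T := by exact_mod_cast hT
  have hT0 : Nonempty (Fin T) := ⟨⟨0, hT⟩⟩
  set A : Fin T → Set Ω := fun j => {ω | ∀ i, E j ω ≤ E i ω} with hA
  have := isProbabilityMeasure_expMeasure one_pos
  have hmE : Measurable fun ω j => E j ω := measurable_pi_lambda _ hm
  have hmA : ∀ j, MeasurableSet (A j) := fun j => hmE (measurableSet_ringsFirst j)
  have hmap := hind.map_fun_eq_pi_map fun j => (hm j).aemeasurable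
  simp only [hexp] at hmap
  have hPA : ∀ j, P (A j) = Measure.pi (fun _ : Fin T => expMeasure 1) (ringsFirst j) := by
    intro j
    rw [← hmap, Measure.map_apply hmE (measurableSet_ringsFirst j)]
    rfl
  have hd : ∀ i j, i ≠ j → AEDisjoint P (A i) (A j) := by
    intro i j hij
    refine measure_mono_null ?_ (clocks_ne_ae hm hexp hind hij)
    rintro ω ⟨h1, h2⟩
    exact le_antisymm (h1 j) (h2 i)
  have hsum : ∀ J : Finset (Fin T), P.real {ω | ∃ j ∈ J, ∀ i, E j ω ≤ E i ω} =
      ∑ j ∈ J, P.real (A j) := by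
    intro J
    rw [← measureReal_biUnion_finset₀ (fun i _ j _ hij => hd i j hij)
      (fun j _ => (hmA j).nullMeasurableSet)]
    congr 1
    ext ω
    simp [hA]
  obtain ⟨j₀⟩ := hT0
  have hconst : ∀ j, P.real (A j) = P.real (A j₀) := by
    intro j
    rw [measureReal_def, measureReal_def, hPA, hPA, pi_ringsFirst_eq j j₀]
  have huniv := hsum Finset.univ
  have huniv' : {ω | ∃ j ∈ Finset.univ, ∀ i, E j ω ≤ E i ω} = Set.univ := by
    ext ω
    simp only [Finset.mem_univ, true_and, Set.mem_univ, iff_true]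
    have : Nonempty (Fin T) := ⟨j₀⟩
    exact Finite.exists_min fun j => E j ω
  rw [huniv', probReal_univ, Finset.sum_congr rfl (fun j _ => hconst j), Finset.sum_const,
    Finset.card_univ, Fintype.card_fin, nsmul_eq_mul] at huniv
  rw [hsum, Finset.sum_congr rfl (fun j _ => hconst j), Finset.sum_const, nsmul_eq_mul,
    eq_div_iff hT'.ne', mul_assoc, mul_comm _ (T : ℝ), ← huniv, mul_one]

end Clocks

/-! ### The discrete-time urn embedded at the rings -/

section Continuous

variable {Ω : Type*} [mΩ : MeasurableSpace Ω] {P : Measure Ω}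
  {a b c d α β : ℕ} {ℱ : Filtration ℕ mΩ} {V : ℕ → Ω → ℕ × ℕ} {τ : ℕ → Ω → ℝ}
  {E : ∀ n : ℕ, Fin (α + β + n * (a + b)) → Ω → ℝ}

theorem total_pos (hαβ : (α, β) ≠ (0, 0)) (k : ℕ) : 0 < α + β + k := by
  exact_mod_cast cast_total_pos hαβ k

theorem IsClockedUrn.ae_total (h : IsClockedUrn P a b c d α β ℱ V τ E)
    (hbalance : a + b = c + d) (n : ℕ) :
    ∀ᵐ ω ∂P, (V n ω).1 + (V n ω).2 = α + β + n * (a + b) := by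
  induction n with
  | zero =>
    filter_upwards [h.initial_V] with ω hω
    simp [hω]
  | succ n ih =>
    filter_upwards [ih, h.ring] with ω h1 h2
    obtain ⟨j, -, -, h3⟩ := h2 n
    rw [h3, Nat.succ_mul]
    split_ifs <;> simp only [Prod.fst_add, Prod.snd_add] <;> omega

theorem sum_draw_eq {T : ℕ} {v : ℕ × ℕ} (hv : v.1 + v.2 = T) (x y : ℝ) :
    ∑ j : Fin T, (if (j : ℕ) < v.1 then x else y) = v.1 * x + v.2 * y := by
  subst hv
  rw [Fin.sum_univ_add]
  simp

/-- A uniform clock index amounts to a uniform ball: `v.1` of the indices are red. -/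
theorem card_draw_div {T : ℕ} (v w : ℕ × ℕ) (hv : v.1 + v.2 = T) :
    ((Finset.univ.filter fun j : Fin T =>
      w = v + if (j : ℕ) < v.1 then (a, b) else (c, d)).card : ℝ) / T = stepProb a b c d v w := by
  have h : ((Finset.univ.filter fun j : Fin T =>
      w = v + if (j : ℕ) < v.1 then (a, b) else (c, d)).card : ℝ) =
      v.1 * (if w = v + (a, b) then 1 else 0) + v.2 * (if w = v + (c, d) then 1 else 0) := by
    rw [← sum_draw_eq hv, Finset.card_filter, Nat.cast_sum]
    refine Finset.sum_congr rfl fun j _ => ?_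
    by_cases hj : (j : ℕ) < v.1 <;> simp [hj]
  have hT : (T : ℝ) = v.1 + v.2 := by
    rw [← hv]
    push_cast
    ring
  rw [h, stepProb, hT]
  ring

variable [IsProbabilityMeasure P]

/-- The compositions at the successive rings form a discrete-time urn. -/
theorem IsClockedUrn.isDiscreteTimeUrn (h : IsClockedUrn P a b c d α β ℱ V τ E)
    (hbalance : a + b = c + d) (hαβ : (α, β) ≠ (0, 0)) :
    IsDiscreteTimeUrn P a b c d α β V := by
  refine ⟨fun n => (h.measurable_V n).mono (ℱ.le n) le_rfl, h.initial_V, fun n u => ?_⟩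
  have hA : MeasurableSet[ℱ n] {ω | ∀ k ≤ n, V k ω = u k} := by
    have : {ω | ∀ k ≤ n, V k ω = u k} = ⋂ k, ⋂ (_ : k ≤ n), V k ⁻¹' {u k} := by
      ext ω
      simp
    rw [this]
    exact MeasurableSet.iInter fun k => MeasurableSet.iInter fun hk =>
      ℱ.mono hk _ (h.measurable_V k (MeasurableSet.singleton _))
  set A := {ω | ∀ k ≤ n, V k ω = u k} with hAdef
  set J := Finset.univ.filter fun j : Fin (α + β + n * (a + b)) =>
    u (n + 1) = u n + if (j : ℕ) < (u n).1 then (a, b) else (c, d) with hJ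
  set G := {ω | ∃ j ∈ J, ∀ i, E n j ω ≤ E n i ω} with hG
  have hGm : MeasurableSet[MeasurableSpace.comap (fun ω j => E n j ω) MeasurableSpace.pi] G := by
    refine ⟨⋃ j ∈ J, ringsFirst j,
      Finset.measurableSet_biUnion _ fun j _ => measurableSet_ringsFirst j, ?_⟩
    ext ω
    simp [hG, ringsFirst]
  -- Without ties the ball named in `ring` is the only first ringer, so the event of the draw is
  -- measurable in the clocks alone.
  have hties : ∀ᵐ ω ∂P, ∀ i j, i ≠ j → E n i ω ≠ E n j ω := by
    refine ae_all_iff.2 fun i => ae_all_iff.2 fun j => ?_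
    by_cases hij : i = j
    · exact ae_of_all _ fun _ hne => absurd hij hne
    · filter_upwards [measure_eq_zero_iff_ae_notMem.1
        (clocks_ne_ae (h.measurable_E n) (h.clocks_exp n) (h.clocks_indep n) hij)] with ω hω _
      exact hω
  have hset : {ω | ∀ k ≤ n + 1, V k ω = u k} =ᵐ[P] (A ∩ G : Set Ω) := by
    refine eventuallyEq_set.2 ?_
    filter_upwards [h.ring, hties] with ω h1 h2
    obtain ⟨j, hjmin, -, hjV⟩ := h1 n
    constructor
    · intro hω
      have hω' : ∀ k ≤ n + 1, V k ω = u k := hω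
      refine ⟨fun k hk => hω' k (by omega), j, ?_, hjmin⟩
      rw [hJ, Finset.mem_filter]
      refine ⟨Finset.mem_univ _, ?_⟩
      rw [← hω' (n + 1) le_rfl, ← hω' n (by omega)]
      exact hjV
    · rintro ⟨hω, i, hi, himin⟩
      have hω' : ∀ k ≤ n, V k ω = u k := hω
      obtain rfl : i = j := by
        by_contra hij
        exact h2 i j hij (le_antisymm (himin j) (hjmin i))
      rw [hJ, Finset.mem_filter] at hi
      intro k hk
      rcases Nat.lt_or_ge k (n + 1) with hlt | hge
      · exact hω' k (by omega)
      · obtain rfl : k = n + 1 := by omega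
        rw [hjV, hω' n le_rfl]
        exact hi.2.symm
  rw [measureReal_congr hset, measureReal_def, Set.inter_comm,
    (Indep_iff _ _ _).1 (h.clocks_indep_past n) G A hGm hA, ENNReal.toReal_mul, mul_comm,
    ← measureReal_def, ← measureReal_def]
  -- If `A` is null both sides vanish. Otherwise some point of `A` has the correct total, so `u n`
  -- does too.
  by_cases h0 : P A = 0
  · simp [measureReal_def, h0]
  · congr 1
    obtain ⟨ω, hωA, hω⟩ :=
      ((frequently_ae_mem_iff.2 h0).and_eventually (h.ae_total hbalance n)).exists
    have hv : (u n).1 + (u n).2 = α + β + n * (a + b) := by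
      rw [← hω, (show ∀ k ≤ n, V k ω = u k from hωA) n le_rfl]
    rw [hG, measureReal_exists_ringsFirst (total_pos hαβ _) (h.measurable_E n) (h.clocks_exp n)
      (h.clocks_indep n), hJ]
    exact card_draw_div (u n) (u (n + 1)) hv

end Continuous

/-! ### The discounted number of balls -/

theorem comap_measurable_iInf {Ω ι : Type*} [Countable ι] (X : ι → Ω → ℝ) :
    Measurable[MeasurableSpace.comap (fun ω j => X j ω) MeasurableSpace.pi]
      fun ω => ⨅ j, X j ω := by
  have h1 : Measurable[MeasurableSpace.comap (fun ω j => X j ω) MeasurableSpace.pi]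
      (fun ω j => X j ω) := comap_measurable _
  exact (Measurable.iInf fun j => measurable_pi_apply j).comp h1

/-- The discounted total number of balls `T_n e ^ (-S τ_n)` at the rings. -/
noncomputable def discountedTotal {Ω : Type*} (a b α β : ℕ) (τ : ℕ → Ω → ℝ) (n : ℕ) (ω : Ω) : ℝ :=
  ((α + β + n * (a + b) : ℕ) : ℝ) * Real.exp (-((a : ℝ) + b) * τ n ω)

theorem discountedTotal_nonneg {Ω : Type*} (a b α β : ℕ) (τ : ℕ → Ω → ℝ) (n : ℕ) (ω : Ω) :
    0 ≤ discountedTotal a b α β τ n ω := by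
  rw [discountedTotal]
  positivity

section Continuous

variable {Ω : Type*} [mΩ : MeasurableSpace Ω] {P : Measure Ω}
  {a b c d α β : ℕ} {ℱ : Filtration ℕ mΩ} {V : ℕ → Ω → ℕ × ℕ} {τ : ℕ → Ω → ℝ}
  {E : ∀ n : ℕ, Fin (α + β + n * (a + b)) → Ω → ℝ}

theorem IsClockedUrn.ae_time_succ (h : IsClockedUrn P a b c d α β ℱ V τ E)
    (hαβ : (α, β) ≠ (0, 0)) (n : ℕ) :
    ∀ᵐ ω ∂P, τ (n + 1) ω = τ n ω + ⨅ j, E n j ω := by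
  have : Nonempty (Fin (α + β + n * (a + b))) := ⟨⟨0, total_pos hαβ _⟩⟩
  filter_upwards [h.ring] with ω hω
  obtain ⟨j, hj, hτ, -⟩ := hω n
  rw [hτ]
  congr 1
  exact le_antisymm (le_ciInf hj) (ciInf_le (Set.finite_range _).bddBelow j)

variable [IsProbabilityMeasure P]

theorem IsClockedUrn.ae_clocks_nonneg (h : IsClockedUrn P a b c d α β ℱ V τ E) (n : ℕ) :
    ∀ᵐ ω ∂P, ∀ j, 0 ≤ E n j ω :=
  ae_all_iff.2 fun j => ae_nonneg_of_map_expMeasure (h.measurable_E n j) (h.clocks_exp n j)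

theorem IsClockedUrn.ae_time_nonneg (h : IsClockedUrn P a b c d α β ℱ V τ E) (n : ℕ) :
    ∀ᵐ ω ∂P, 0 ≤ τ n ω := by
  induction n with
  | zero =>
    filter_upwards [h.initial_τ] with ω hω
    rw [hω]
  | succ n ih =>
    filter_upwards [ih, h.ring, h.ae_clocks_nonneg n] with ω h1 h2 h3
    obtain ⟨j, -, hj, -⟩ := h2 n
    rw [hj]
    exact add_nonneg h1 (h3 j)

theorem IsClockedUrn.integrable_exp_neg_time (h : IsClockedUrn P a b c d α β ℱ V τ E) (n : ℕ)
    {s : ℝ} (hs : 0 ≤ s) : Integrable (fun ω => Real.exp (-s * τ n ω)) P := by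
  refine Integrable.of_bound
    (((h.measurable_τ n).mono (ℱ.le n) le_rfl).const_mul (-s)).exp.aestronglyMeasurable 1 ?_
  filter_upwards [h.ae_time_nonneg n] with ω hω
  rw [Real.norm_eq_abs, abs_of_pos (Real.exp_pos _), Real.exp_le_one_iff]
  nlinarith

theorem IsClockedUrn.integrable_exp_neg_iInf (h : IsClockedUrn P a b c d α β ℱ V τ E) (n : ℕ)
    {s : ℝ} (hs : 0 ≤ s) : Integrable (fun ω => Real.exp (-s * ⨅ j, E n j ω)) P := by
  refine Integrable.of_bound
    ((measurable_iInf_clocks (h.measurable_E n)).const_mul (-s)).exp.aestronglyMeasurable 1 ?_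
  filter_upwards [h.ae_clocks_nonneg n] with ω hω
  rw [Real.norm_eq_abs, abs_of_pos (Real.exp_pos _), Real.exp_le_one_iff]
  have := Real.iInf_nonneg hω
  nlinarith

/-- The waiting time is the minimum of `T` fresh clocks, independent of the past and exponential of
parameter `T`; its Laplace transform is the constant `T / (T + s)`. -/
theorem IsClockedUrn.condExp_exp_neg_time_succ (h : IsClockedUrn P a b c d α β ℱ V τ E)
    (hαβ : (α, β) ≠ (0, 0)) (n : ℕ) {s : ℝ} (hs : 0 ≤ s) :
    P[fun ω => Real.exp (-s * τ (n + 1) ω) | ℱ n] =ᵐ[P]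
      fun ω => Real.exp (-s * τ n ω) *
        ((α + β + n * (a + b) : ℕ) / ((α + β + n * (a + b) : ℕ) + s)) := by
  have hmul : (fun ω => Real.exp (-s * τ (n + 1) ω)) =ᵐ[P]
      (fun ω => Real.exp (-s * τ n ω)) * fun ω => Real.exp (-s * ⨅ j, E n j ω) := by
    filter_upwards [h.ae_time_succ hαβ n] with ω hω
    rw [hω, mul_add, Real.exp_add, Pi.mul_apply]
  have hmeas : Measurable[ℱ n] fun ω => Real.exp (-s * τ n ω) :=
    ((h.measurable_τ n).const_mul (-s)).exp
  have hindep := condExp_indep_eq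
    (measurable_pi_lambda _ fun j => h.measurable_E n j).comap_le (ℱ.le n)
    ((comap_measurable_iInf (E n)).const_mul (-s)).exp.stronglyMeasurable
    (h.clocks_indep_past n)
  refine (condExp_congr_ae hmul).trans ?_
  refine (condExp_mul_of_stronglyMeasurable_left hmeas.stronglyMeasurable
    ((h.integrable_exp_neg_time (n + 1) hs).congr hmul)
    (h.integrable_exp_neg_iInf n hs)).trans ?_
  filter_upwards [hindep] with ω hω
  rw [Pi.mul_apply, hω, integral_exp_neg_iInf_clocks (total_pos hαβ _) (h.measurable_E n)
    (h.clocks_exp n) (h.clocks_indep n) hs]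

theorem IsClockedUrn.integral_exp_neg_time_succ (h : IsClockedUrn P a b c d α β ℱ V τ E)
    (hαβ : (α, β) ≠ (0, 0)) (n : ℕ) {s : ℝ} (hs : 0 ≤ s) :
    ∫ ω, Real.exp (-s * τ (n + 1) ω) ∂P = (∫ ω, Real.exp (-s * τ n ω) ∂P) *
        ((α + β + n * (a + b) : ℕ) / ((α + β + n * (a + b) : ℕ) + s)) := by
  rw [← integral_condExp (ℱ.le n), integral_congr_ae (h.condExp_exp_neg_time_succ hαβ n hs),
    integral_mul_const]

/-- The Laplace transform of the ringing times, at multiples of the balance. -/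
theorem IsClockedUrn.prod_mul_integral_exp_neg_time (h : IsClockedUrn P a b c d α β ℱ V τ E)
    (hαβ : (α, β) ≠ (0, 0)) (k n : ℕ) :
    (∏ i ∈ Finset.range k, ((α + β + (n + i) * (a + b) : ℕ) : ℝ)) *
      ∫ ω, Real.exp (-(k * ((a : ℝ) + b)) * τ n ω) ∂P =
      ∏ i ∈ Finset.range k, ((α + β + i * (a + b) : ℕ) : ℝ) := by
  induction n with
  | zero =>
    have : ∫ ω, Real.exp (-(k * ((a : ℝ) + b)) * τ 0 ω) ∂P = ∫ _, (1 : ℝ) ∂P := by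
      refine integral_congr_ae ?_
      filter_upwards [h.initial_τ] with ω hω
      simp [hω]
    rw [this]
    simp
  | succ n ih =>
    rw [h.integral_exp_neg_time_succ hαβ n (by positivity), ← ih]
    -- At `s = k S` the denominator `T_n + s` is itself a total, `T_{n+k}`. Replacing `T_n` by
    -- `T_{n+k}` slides the window of `k` factors by one, so the left side does not depend on `n`.
    have e1 : ((α + β + n * (a + b) : ℕ) : ℝ) + k * ((a : ℝ) + b) =
        ((α + β + (n + k) * (a + b) : ℕ) : ℝ) := by
      push_cast
      ring
    have e2 : (∏ i ∈ Finset.range k, ((α + β + (n + 1 + i) * (a + b) : ℕ) : ℝ)) *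
        ((α + β + n * (a + b) : ℕ) : ℝ) =
        (∏ i ∈ Finset.range k, ((α + β + (n + i) * (a + b) : ℕ) : ℝ)) *
          ((α + β + (n + k) * (a + b) : ℕ) : ℝ) := by
      rw [← Finset.prod_range_succ (fun i => ((α + β + (n + i) * (a + b) : ℕ) : ℝ)),
        Finset.prod_range_succ']
      simp only [add_zero]
      congr 1
      refine Finset.prod_congr rfl fun i _ => ?_
      rw [add_assoc n 1 i, add_comm 1 i]
    have h0 : ((α + β + (n + k) * (a + b) : ℕ) : ℝ) ≠ 0 := (cast_total_pos hαβ _).ne'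
    rw [e1]
    calc _ = ((∏ i ∈ Finset.range k, ((α + β + (n + 1 + i) * (a + b) : ℕ) : ℝ)) *
          ((α + β + n * (a + b) : ℕ) : ℝ)) *
          (∫ ω, Real.exp (-(k * ((a : ℝ) + b)) * τ n ω) ∂P) /
            ((α + β + (n + k) * (a + b) : ℕ) : ℝ) := by ring
      _ = _ := by
        rw [e2]
        field_simp

/-- `T_n ^ k` is at most the product `T_n ⋯ T_{n+k-1}`, whose discounted mean keeps its initial
value; each factor of that value is at most `C k`. -/
theorem IsClockedUrn.integral_discountedTotal_pow_le (h : IsClockedUrn P a b c d α β ℱ V τ E)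
    (hαβ : (α, β) ≠ (0, 0)) (k n : ℕ) :
    ∫ ω, discountedTotal a b α β τ n ω ^ k ∂P ≤
      (((α + β + (a + b) : ℕ) : ℝ) * k) ^ k := by
  have e : ∀ ω, discountedTotal a b α β τ n ω ^ k = ((α + β + n * (a + b) : ℕ) : ℝ) ^ k *
      Real.exp (-(k * ((a : ℝ) + b)) * τ n ω) := by
    intro ω
    rw [discountedTotal, mul_pow, ← Real.exp_nat_mul]
    congr 2
    ring
  simp only [e]
  rw [integral_const_mul]
  have hint : 0 ≤ ∫ ω, Real.exp (-(k * ((a : ℝ) + b)) * τ n ω) ∂P :=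
    integral_nonneg fun _ => (Real.exp_pos _).le
  calc _ ≤ (∏ i ∈ Finset.range k, ((α + β + (n + i) * (a + b) : ℕ) : ℝ)) *
        ∫ ω, Real.exp (-(k * ((a : ℝ) + b)) * τ n ω) ∂P := by
        gcongr
        rw [← Finset.card_range k, ← Finset.prod_const, Finset.card_range]
        refine Finset.prod_le_prod (fun _ _ => by positivity) fun i _ => ?_
        gcongr
        omega
    _ = ∏ i ∈ Finset.range k, ((α + β + i * (a + b) : ℕ) : ℝ) :=
        h.prod_mul_integral_exp_neg_time hαβ k n
    _ ≤ ∏ i ∈ Finset.range k, (((α + β + (a + b) : ℕ) : ℝ) * k) := by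
        refine Finset.prod_le_prod (fun _ _ => by positivity) fun i hi => ?_
        have hi' : i + 1 ≤ k := Finset.mem_range.1 hi
        rw [← Nat.cast_mul, Nat.cast_le]
        nlinarith [Nat.zero_le α, Nat.zero_le β, Nat.zero_le (a + b),
          Nat.mul_le_mul_left (α + β) (show 1 ≤ k by omega),
          Nat.mul_le_mul_left (a + b) (show i ≤ k by omega)]
    _ = _ := by rw [Finset.prod_const, Finset.card_range]

theorem IsClockedUrn.integrable_discountedTotal_pow (h : IsClockedUrn P a b c d α β ℱ V τ E)
    (k n : ℕ) : Integrable (fun ω => discountedTotal a b α β τ n ω ^ k) P := by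
  have e : ∀ ω, discountedTotal a b α β τ n ω ^ k = ((α + β + n * (a + b) : ℕ) : ℝ) ^ k *
      Real.exp (-(k * ((a : ℝ) + b)) * τ n ω) := by
    intro ω
    rw [discountedTotal, mul_pow, ← Real.exp_nat_mul]
    congr 2
    ring
  simp only [e]
  exact (h.integrable_exp_neg_time n (by positivity)).const_mul _

/-- Markov's inequality for the moment of order `N` at the level `e C N`: the quotient `(C N) ^ N /
(e C N) ^ N` is `exp(-N)`. -/
theorem IsClockedUrn.discountedTotal_tail (h : IsClockedUrn P a b c d α β ℱ V τ E)
    (hαβ : (α, β) ≠ (0, 0)) {N : ℕ} (hN : 1 ≤ N) (n : ℕ) :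
    P.real {ω | Real.exp 1 * ((α + β + (a + b) : ℕ) : ℝ) * N ≤ discountedTotal a b α β τ n ω} ≤
      Real.exp (-1 * N) := by
  set C := ((α + β + (a + b) : ℕ) : ℝ)
  have hC : 0 < C := cast_total_pos hαβ _
  have hN0 : (0 : ℝ) < N := by exact_mod_cast hN
  have hy : 0 < Real.exp 1 * C * N := by positivity
  have hmarkov := mul_meas_ge_le_integral_of_nonneg
    (ae_of_all P fun ω => pow_nonneg (discountedTotal_nonneg a b α β τ n ω) N) (h.integrable_discountedTotal_pow N n) ((Real.exp 1 * C * N) ^ N)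
  have h1 := hmarkov.trans (h.integral_discountedTotal_pow_le hαβ N n)
  have hsub : P.real {ω | Real.exp 1 * C * N ≤ discountedTotal a b α β τ n ω} ≤
      P.real {ω | (Real.exp 1 * C * N) ^ N ≤ discountedTotal a b α β τ n ω ^ N} :=
    measureReal_mono fun ω (hω : _ ≤ discountedTotal a b α β τ n ω) =>
      pow_le_pow_left₀ hy.le hω N
  refine hsub.trans ?_
  have h2 : (C * N) ^ N = (Real.exp 1 * C * N) ^ N * Real.exp (-1 * N) := by
    rw [mul_assoc (Real.exp 1), mul_pow (Real.exp 1), ← Real.exp_nat_mul, mul_right_comm,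
      ← Real.exp_add]
    simp
  rw [h2] at h1
  exact le_of_mul_le_mul_left h1 (by positivity)

/-- At `s = S` the factor `T_n / (T_n + S)` equals `T_n / T_{n+1}`, which cancels the growth of the
total. -/
theorem IsClockedUrn.martingale_discountedTotal (h : IsClockedUrn P a b c d α β ℱ V τ E)
    (hαβ : (α, β) ≠ (0, 0)) : Martingale (discountedTotal a b α β τ) ℱ P := by
  refine martingale_nat (fun n => ?_) (fun n => ?_) fun n => ?_
  · exact ((((h.measurable_τ n).const_mul _).exp).const_mul _).stronglyMeasurable
  · simpa using h.integrable_discountedTotal_pow 1 n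
  · have hS : (0 : ℝ) ≤ (a : ℝ) + b := by positivity
    have h1 := condExp_smul (μ := P) ((α + β + (n + 1) * (a + b) : ℕ) : ℝ)
      (fun ω => Real.exp (-((a : ℝ) + b) * τ (n + 1) ω)) (ℱ n)
    have h2 : discountedTotal a b α β τ (n + 1) = ((α + β + (n + 1) * (a + b) : ℕ) : ℝ) •
        fun ω => Real.exp (-((a : ℝ) + b) * τ (n + 1) ω) := rfl
    rw [h2]
    filter_upwards [h1, h.condExp_exp_neg_time_succ hαβ n hS] with ω e1 e2
    have e3 : ((α + β + n * (a + b) : ℕ) : ℝ) + ((a : ℝ) + b) =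
        ((α + β + (n + 1) * (a + b) : ℕ) : ℝ) := by
      push_cast
      ring
    have h0 : ((α + β + (n + 1) * (a + b) : ℕ) : ℝ) ≠ 0 := (cast_total_pos hαβ _).ne'
    rw [e1, Pi.smul_apply, e2, e3, discountedTotal, smul_eq_mul]
    field_simp

theorem IsClockedUrn.exists_limit_discountedTotal (h : IsClockedUrn P a b c d α β ℱ V τ E)
    (hαβ : (α, β) ≠ (0, 0)) :
    ∃ ξ : Ω → ℝ, Measurable ξ ∧
      (∀ᵐ ω ∂P, Tendsto (fun n => discountedTotal a b α β τ n ω) atTop (𝓝 (ξ ω))) ∧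
      ∃ K > 0, ∀ N : ℕ, 1 ≤ N → P.real {ω | K * N < |ξ ω|} ≤ Real.exp (-1 * N) := by
  have hbdd : ∀ n, eLpNorm (discountedTotal a b α β τ n) 1 P ≤
      ((α + β + (a + b) : ℕ) : ℝ≥0) := by
    intro n
    have hint : Integrable (discountedTotal a b α β τ n) P := by
      simpa using h.integrable_discountedTotal_pow 1 n
    rw [eLpNorm_one_eq_lintegral_enorm, ← ofReal_integral_norm_eq_lintegral_enorm hint]
    have h1 := h.integral_discountedTotal_pow_le hαβ 1 n
    simp only [pow_one, Nat.cast_one, mul_one] at h1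
    have h2 : ∫ ω, ‖discountedTotal a b α β τ n ω‖ ∂P =
        ∫ ω, discountedTotal a b α β τ n ω ∂P := by
      congr 1
      funext ω
      exact abs_of_nonneg (discountedTotal_nonneg a b α β τ n ω)
    rw [h2]
    refine (ENNReal.ofReal_le_ofReal h1).trans (le_of_eq ?_)
    rw [ENNReal.ofReal_natCast, ENNReal.coe_natCast]
  obtain ⟨ξ, hξ, hlim⟩ := measurable_limit_of_tendsto_metrizable_ae
    (fun n => ((h.martingale_discountedTotal hαβ).stronglyMeasurable n).measurable.mono
      (ℱ.le n) le_rfl |>.aemeasurable)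
    ((h.martingale_discountedTotal hαβ).submartingale.exists_ae_tendsto_of_bdd hbdd)
  refine ⟨ξ, hξ, hlim, Real.exp 1 * ((α + β + (a + b) : ℕ) : ℝ),
    mul_pos (Real.exp_pos _) (cast_total_pos hαβ _), fun N hN => ?_⟩
  refine measureReal_lt_limit_le (N := 0) (X := discountedTotal a b α β τ) ?_
    fun n _ => h.discountedTotal_tail hαβ hN n
  filter_upwards [hlim] with ω hω
  refine hω.abs.congr fun n => abs_of_nonneg (discountedTotal_nonneg a b α β τ n ω)

end Continuous

/-! ### The continuous-time limit -/

/-- A process that is constant between the times `τ n`, and whose discounted values at both ends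
of each interval converge, converges. -/
theorem tendsto_of_tendsto_at_rings {m x : ℝ} (hm : 0 ≤ m) {t₀ z : ℕ → ℝ} {f : ℝ≥0 → ℝ}
    (hτ : Tendsto t₀ atTop atTop)
    (hf : ∀ (t : ℝ≥0) (n : ℕ), t₀ n ≤ t → (t : ℝ) < t₀ (n + 1) → f t = z n)
    (h1 : Tendsto (fun n => Real.exp (-m * t₀ n) * z n) atTop (𝓝 x))
    (h2 : Tendsto (fun n => Real.exp (-m * t₀ (n + 1)) * z n) atTop (𝓝 x)) :
    Tendsto (fun t : ℝ≥0 => Real.exp (-m * t) * f t) atTop (𝓝 x) := by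
  rw [Metric.tendsto_atTop]
  intro ε hε
  obtain ⟨N, hN⟩ := eventually_atTop.1
    ((Metric.tendsto_nhds.1 h1 ε hε).and (Metric.tendsto_nhds.1 h2 ε hε))
  refine ⟨(t₀ N).toNNReal, fun t ht => ?_⟩
  have ht' : t₀ N ≤ t := Real.toNNReal_le_iff_le_coe.1 ht
  have hex : ∃ n, N ≤ n ∧ (t : ℝ) < t₀ (n + 1) := by
    obtain ⟨n, hn1, hn2⟩ := ((eventually_ge_atTop N).and
      ((tendsto_add_atTop_iff_nat 1).2 hτ |>.eventually_gt_atTop (t : ℝ))).exists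
    exact ⟨n, hn1, hn2⟩
  classical
  -- Minimality of `n` yields `t₀ n ≤ t`, so no monotonicity of the ringing times is needed.
  set n := Nat.find hex with hn
  obtain ⟨hNn, hlt⟩ := Nat.find_spec hex
  rw [← hn] at hNn hlt
  have hge : t₀ n ≤ t := by
    rcases Nat.eq_or_lt_of_le hNn with heq | hgt
    · rwa [← heq]
    · by_contra hcon
      push Not at hcon
      have := Nat.find_min hex (m := n - 1) (by omega)
      apply this
      refine ⟨by omega, ?_⟩
      rwa [show n - 1 + 1 = n by omega]
  rw [hf t n hge hlt]
  obtain ⟨b1, b2⟩ := hN n hNn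
  have c1 : Real.exp (-m * t) ≤ Real.exp (-m * t₀ n) := Real.exp_le_exp.2 (by nlinarith)
  have c2 : Real.exp (-m * t₀ (n + 1)) ≤ Real.exp (-m * t) := Real.exp_le_exp.2 (by nlinarith)
  rw [Real.dist_eq, abs_lt] at *
  -- On the interval `exp(-m t) z n` lies between its values at the two ends; the sign of `z n`
  -- decides which is larger.
  rcases le_total 0 (z n) with hz | hz
  · constructor <;> nlinarith
  · constructor <;> nlinarith

section Continuous

variable {Ω : Type*} [mΩ : MeasurableSpace Ω] {P : Measure Ω} [IsProbabilityMeasure P]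
  {a b c d α β : ℕ}

theorem tendsto_natCast_div_total (hb : b ≠ 0) (α β k : ℕ) :
    Tendsto (fun n : ℕ => (n : ℝ) / ((α + β + (n + k) * (a + b) : ℕ) : ℝ)) atTop
      (𝓝 (1 / ((a : ℝ) + b))) := by
  have hb' : (0 : ℝ) < b := by exact_mod_cast Nat.pos_of_ne_zero hb
  have hS : (0 : ℝ) < (a : ℝ) + b := by positivity
  have h := (tendsto_natCast_div_add_atTop
    (((α : ℝ) + β + k * (a + b)) / ((a : ℝ) + b))).mul_const (1 / ((a : ℝ) + b))
  rw [one_mul] at h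
  refine h.congr fun n => ?_
  push_cast
  rw [div_mul_div_comm, mul_one]
  congr 1
  field_simp
  ring

/-- The continuous-time urn has a limit, and the law of the limit is determined by its moments. -/
theorem IsContinuousTimeUrn.exists_limit_isDeterminedByMoments {U : ℝ≥0 → Ω → ℕ × ℕ}
    (hU : IsContinuousTimeUrn P a b c d α β U) (hbalance : a + b = c + d) (hb : b ≠ 0)
    (hc : c ≠ 0) (hσ : 1 / 2 < ratio a b c) (hαβ : (α, β) ≠ (0, 0)) :
    ∃ W : Ω → ℝ, IsContinuousTimeLimit P a b c U W ∧ IsDeterminedByMoments (P.map W) := by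
  obtain ⟨ℱ, V, τ, E, h, hUV⟩ := hU
  obtain ⟨W, ⟨hWm, hWlim⟩, K₁, hK₁, htail₁⟩ :=
    (h.isDiscreteTimeUrn hbalance hαβ).exists_limit hbalance hb hσ hαβ
  obtain ⟨ξ, hξm, hξlim, K₂, hK₂, htail₂⟩ := h.exists_limit_discountedTotal hαβ
  have hb' : (0 : ℝ) < b := by exact_mod_cast Nat.pos_of_ne_zero hb
  have hS : (0 : ℝ) < (a : ℝ) + b := by positivity
  have hσ0 : 0 < ratio a b c := by linarith
  have hσ1 : ratio a b c < 1 := ratio_lt_one hb hc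
  set σ := ratio a b c with hσdef
  have hm : ((a : ℝ) - c) = σ * ((a : ℝ) + b) := (ratio_mul hb).symm
  -- As `m = σ S`, `exp(-m τ_n) = (T_n exp(-S τ_n)) ^ σ (n / T_n) ^ σ n ^ (-σ)`; the three pieces
  -- give `ξ ^ σ`, `S ^ (-σ)` and, with `u₂`, `W`.
  set X : Ω → ℝ := fun ω => (ξ ω) ^ σ * (1 / ((a : ℝ) + b)) ^ σ * W ω with hX
  have hXm : Measurable X := ((hξm.pow_const σ).mul_const _).mul hWm
  refine ⟨X, ⟨hXm, ?_⟩, ?_⟩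
  · filter_upwards [hWlim, hξlim, hUV] with ω hW hξ hUω
    -- The shifts `0` and `1` are the two ends of the interval on which the composition is `V n`.
    have hshift : ∀ k : ℕ, Tendsto
        (fun n => Real.exp (-((a : ℝ) - c) * τ (n + k) ω) * u₂ a b c (V n ω)) atTop
        (𝓝 (X ω)) := by
      intro k
      have hY := (((tendsto_add_atTop_iff_nat k).2 hξ).rpow_const (p := σ) (Or.inr hσ0.le)).mul
        ((tendsto_natCast_div_total (a := a) hb α β k).rpow_const (p := σ) (Or.inr hσ0.le))
      refine (hY.mul hW).congr' ?_
      filter_upwards [eventually_ge_atTop 1] with n hn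
      have hn0 : (0 : ℝ) < n := by exact_mod_cast hn
      have hT := cast_total_pos hαβ ((n + k) * (a + b))
      have hpow : 0 < (n : ℝ) ^ σ := Real.rpow_pos_of_pos hn0 _
      have hpowT : 0 < ((α + β + (n + k) * (a + b) : ℕ) : ℝ) ^ σ := Real.rpow_pos_of_pos hT _
      have hexp : Real.exp (-((a : ℝ) + b) * τ (n + k) ω) ^ σ =
          Real.exp (-((a : ℝ) - c) * τ (n + k) ω) := by
        rw [← Real.exp_mul, hm]
        congr 1
        ring
      rw [discountedTotal, Real.mul_rpow hT.le (Real.exp_pos _).le,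
        Real.div_rpow hn0.le hT.le, hexp]
      field_simp
    -- The process does not explode: `T_n exp(-S τ_n)` converges while `T_n` tends to infinity, so
    -- `exp(-S τ_n)` tends to `0`.
    have hτ : Tendsto (fun n => τ n ω) atTop atTop := by
      have hinv : Tendsto (fun n : ℕ => ((α + β + n * (a + b) : ℕ) : ℝ)⁻¹) atTop (𝓝 0) := by
        refine tendsto_inv_atTop_zero.comp (tendsto_natCast_atTop_atTop.comp ?_)
        refine tendsto_atTop_mono (fun n => ?_) tendsto_id
        have : 1 ≤ a + b := by omega
        simp only [id]
        nlinarith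
      have h0 : Tendsto (fun n => Real.exp (-((a : ℝ) + b) * τ n ω)) atTop (𝓝 0) := by
        have := hξ.mul hinv
        rw [mul_zero] at this
        refine this.congr fun n => ?_
        have hT := (cast_total_pos hαβ (n * (a + b))).ne'
        rw [discountedTotal, mul_comm, inv_mul_cancel_left₀ hT]
      have h1 := Real.tendsto_exp_comp_nhds_zero.1 h0
      have h2 := (tendsto_neg_atBot_atTop.comp h1).atTop_div_const hS
      refine h2.congr fun n => ?_
      simp only [Function.comp]
      field_simp
    have h1 := hshift 0
    simp only [add_zero] at h1
    exact tendsto_of_tendsto_at_rings (f := fun t => u₂ a b c (U t ω))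
      (z := fun n => u₂ a b c (V n ω)) (by rw [hm]; positivity) hτ
      (fun t n hl hr => by rw [hUω t n hl hr]) h1 (hshift 1)
  -- The constant `3` adds the tail `2 exp(-N)` of `W` to the tail `exp(-N)` of `ξ`; off both events
  -- the powers `N ^ σ` and `N ^ (1 - σ)` multiply to `N`.
  · refine isDeterminedByMoments_map_of_tail P hXm
      (K := K₂ ^ σ * (1 / ((a : ℝ) + b)) ^ σ * K₁) (C := 3) (c := 1)
      (by positivity) one_pos fun N hN => ?_
    have hN0 : (0 : ℝ) < N := by exact_mod_cast hN
    calc _ ≤ P.real ({ω | K₂ * N < |ξ ω|} ∪ {ω | K₁ * (N : ℝ) ^ (1 - σ) < |W ω|}) := by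
          refine measureReal_mono fun ω hω => ?_
          by_contra hcon
          have hξW : ¬ (K₂ * N < |ξ ω| ∨ K₁ * (N : ℝ) ^ (1 - σ) < |W ω|) := hcon
          push Not at hξW
          refine absurd (show _ < |X ω| from hω) (not_lt.2 ?_)
          rw [hX]
          simp only [abs_mul]
          calc |ξ ω ^ σ| * |(1 / ((a : ℝ) + b)) ^ σ| * |W ω|
              ≤ (K₂ * N) ^ σ * (1 / ((a : ℝ) + b)) ^ σ * (K₁ * (N : ℝ) ^ (1 - σ)) := by
                rw [abs_of_nonneg (Real.rpow_nonneg (by positivity : 0 ≤ 1 / ((a : ℝ) + b)) σ)]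
                gcongr
                · exact (Real.abs_rpow_le_abs_rpow _ _).trans
                    (Real.rpow_le_rpow (abs_nonneg _) hξW.1 hσ0.le)
                · exact hξW.2
            _ = K₂ ^ σ * (1 / ((a : ℝ) + b)) ^ σ * K₁ *
                  ((N : ℝ) ^ σ * (N : ℝ) ^ (1 - σ)) := by
                rw [Real.mul_rpow hK₂.le hN0.le]
                ring
            _ = _ := by rw [← Real.rpow_add hN0, add_sub_cancel, Real.rpow_one]
      _ ≤ _ := measureReal_union_le _ _
      _ ≤ _ := by linarith [htail₁ N hN, htail₂ N hN]

end Continuous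

end PolyaUrn

theorem mainTheorem4 (a b c d : ℕ) (hbalance : a + b = c + d) (hb : b ≠ 0) (hc : c ≠ 0)
    (hlarge : 1 / 2 < PolyaUrn.ratio a b c) (α β : ℕ) (hαβ : (α, β) ≠ (0, 0)) :
    (∀ {Ω : Type*} [MeasurableSpace Ω] (P : Measure Ω) [IsProbabilityMeasure P]
      (U : ℕ → Ω → ℕ × ℕ), PolyaUrn.IsDiscreteTimeUrn P a b c d α β U →
        ∃ W : Ω → ℝ, PolyaUrn.IsDiscreteTimeLimit P a b c U W ∧
          PolyaUrn.IsDeterminedByMoments (P.map W)) ∧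
    (∀ {Ω : Type*} [MeasurableSpace Ω] (P : Measure Ω) [IsProbabilityMeasure P]
      (U : ℝ≥0 → Ω → ℕ × ℕ), PolyaUrn.IsContinuousTimeUrn P a b c d α β U →
        ∃ W : Ω → ℝ, PolyaUrn.IsContinuousTimeLimit P a b c U W ∧
          PolyaUrn.IsDeterminedByMoments (P.map W)) := by
  refine ⟨fun P _ U hU => ?_, fun P _ U hU => ?_⟩
  · exact hU.exists_limit_isDeterminedByMoments hbalance hb hlarge hαβ
  · exact hU.exists_limit_isDeterminedByMoments hbalance hb hc hlarge hαβ
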